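/- Noise model. A quantum circuit on a finite set of qubits is executed during $[0,T]$. Each of its finitely many locations (gates, including idle steps and the evolution that accompanies preparations and measurements) acts on a non-empty set of qubits during a time window of positive length, and no qubit takes part in two locations at the same time. The system is coupled to an arbitrary bath, and the joint Hamiltonian is $H=H_S+H_B+H_{SB}$, where $H_S(t)$ is the sum of the Hamiltonians of the gates being executed at time $t$, $H_B$ is an arbitrary self-adjoint bath Hamiltonian (with a unitary propagator), and $$H_{SB}=\sum_{k\ge1}\frac1{k!}\sum_{i_1,\dots,i_k}H^{(k)}_{i_1\dots i_k}.$$ Here $H^{(k)}_{i_1\dots i_k}$ is a bounded self-adjoint, possibly time-dependent operator that acts on the qubits $i_1,\dots,i_k$ and arbitrarily on the bath; it is symmetric in its indices, vanishes if two of them coincide, and has a norm that is bounded uniformly in time. Let $t_0$ be the maximal duration of a location. For a set $I$ of $r$ locations let $E(I)$ be the sum of all terms in the expansion of the joint evolution operator over $[0,T]$ in powers of $H_{SB}$, to all orders, for which every location in $I$ is faulty, i.e. at least one of its qubits is struck at least once by a term of $H_{SB}$ during the execution of that location. The noise has effective noise strength $\varepsilon\ge 0$ if, for every set $I$ of locations,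 with $r=|I|$, the sum $E(I)$ converges and $\|E(I)\|\le\varepsilon^r$. Statement. Fix $p>1$ and $m\in\mathbb N$, put $C(\alpha)=(1-2\alpha)^{-1}$, and for a noise model let $$\alpha_p=\max_{k\ge1}\Big[\frac{k^p}{k!}\Big(\max_{i_1}\sum_{i_2,\dots,i_k}\|H^{(k)}_{i_1\dots i_k}\|\,t_0\Big)\Big]^{1/k},$$ where the inner maximum is over all qubits $i_1$ and all times in $[0,T]$ (a supremum where no maximum is attained), and the sums are over all qubits. Then: 1. $\sum_{k\ge1}\frac1{2k^p}<\infty$, and every noise model in which each location acts on at most $m$ qubits and $\alpha_p<\tfrac12$ has effective noise strength $$\varepsilon=2m\,\alpha_p\,\exp\Big(C(\alpha_p)\sum_{k=1}^\infty\frac1{2k^p}\Big).$$ 2. Consequently the noise can be brought below any threshold: for every $\varepsilon_0>0$ there is $\alpha_0>0$, depending only on $p$, $m$ and $\varepsilon_0$, such that every noise model in which each location acts on at most $m$ qubits and $\alpha_p<\alpha_0$ has an effective noise strength $\varepsilon<\varepsilon_0$. 3. For $p=2$ the bound in 1, as a function of $\alpha=\alpha_2$, equals $2m\alpha\,(e^{\pi^2/12})^{C(\alpha)}$;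 divided by $\alpha$ it tends to $2e^{\pi^2/12}\,m$ as $\alpha\to0^+$, and $|2e^{\pi^2/12}-4.55|<0.005$. -/

import Mathlib

open MeasureTheory Filter Topology

noncomputable section

/-- The joint Hilbert space of the system qubits `Q` and a bath `B`, that is `(ℂ²)^{⊗Q} ⊗ B`:
families of bath vectors indexed by the computational basis strings `Q → Fin 2`, with the
Hilbert-space norm. -/
abbrev JointSpace (Q B : Type*) : Type _ := PiLp 2 (fun _ : Q → Fin 2 => B)

/-- The Hilbert space `(ℂ²)^{⊗Q}` of the system qubits. -/
abbrev SystemSpace (Q : Type*) : Type _ := JointSpace Q ℂ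

section Operators

variable {Q : Type*} [Fintype Q] [DecidableEq Q]
variable {B : Type*} [NormedAddCommGroup B] [InnerProductSpace ℂ B]

/-- The basis string that equals `u` on `S` and `x` off `S`. -/
def patch (S : Finset Q) (x : Q → Fin 2) (u : S → Fin 2) : Q → Fin 2 :=
  fun i => if h : i ∈ S then u ⟨i, h⟩ else x i

/-- `A` acts only on the qubits in `S`, and arbitrarily on the bath `B`: it is the identity on the
qubits off `S`, tensored with an operator on `(ℂ²)^{⊗S} ⊗ B`, whose blocks are `a u v`. -/
def ActsOn (S : Finset Q) (A : JointSpace Q B →L[ℂ] JointSpace Q B) : Prop :=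
  ∃ a : (S → Fin 2) → (S → Fin 2) → (B →L[ℂ] B), ∀ (ψ : JointSpace Q B) (x : Q → Fin 2),
    A ψ x = ∑ v : S → Fin 2, a (fun i => x i) v (ψ (patch S x v))

/-- The operator `A ⊗ V`, for `A` on the system and `V` on the bath. -/
def tensorOp (A : SystemSpace Q →L[ℂ] SystemSpace Q) (V : B →L[ℂ] B) :
    JointSpace Q B →L[ℂ] JointSpace Q B :=
  (PiLp.continuousLinearEquiv 2 ℂ (fun _ : Q → Fin 2 => B)).symm.toContinuousLinearMap ∘L
    ContinuousLinearMap.pi fun x : Q → Fin 2 =>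
      ∑ y : Q → Fin 2, (A (PiLp.single 2 y (1 : ℂ)) x) • (V ∘L PiLp.proj 2 (fun _ => B) y)

end Operators

/-- `U t s` is the unitary propagator (from time `s` to time `t`) of the Schrödinger equation
`i dψ/dt = H(t) ψ`, for a time-dependent, possibly unbounded, Hamiltonian `H`. The equation is
required in integrated form and for a dense set of initial states, so that bounded Hamiltonians
that jump in time and unbounded ones are both covered. -/
structure IsPropagator {E : Type*} [NormedAddCommGroup E] [InnerProductSpace ℂ E]
    [CompleteSpace E] (H : ℝ → E →ₗ.[ℂ] E) (U : ℝ → ℝ → E →L[ℂ] E) : Prop where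
  unitary : ∀ t s, U t s ∈ unitary (E →L[ℂ] E)
  self : ∀ t, U t t = 1
  comp : ∀ t s r, U t s ∘L U s r = U t r
  continuous : ∀ ψ, Continuous fun q : ℝ × ℝ => U q.1 q.2 ψ
  schrodinger : ∀ s, Dense {ψ : E | ∃ φ : ℝ → E,
    (∀ τ, (U τ s ψ, φ τ) ∈ (H τ).graph) ∧
    ∀ t, IntervalIntegrable φ volume s t ∧ U t s ψ = ψ - Complex.I • ∫ τ in s..t, φ τ}

/-- A quantum circuit on the qubits `Q`, with set of locations `Loc`, executed during `[0, T]`.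
The location `l` acts on the qubits `qubits l` during the time window `[start l, finish l)`, under
the Hamiltonian `gateHam l`. No qubit takes part in two locations at the same time. -/
structure Circuit (Q Loc : Type*) [Fintype Q] [DecidableEq Q] where
  T : ℝ
  T_nonneg : 0 ≤ T
  qubits : Loc → Finset Q
  qubits_nonempty : ∀ l, (qubits l).Nonempty
  start : Loc → ℝ
  finish : Loc → ℝ
  start_nonneg : ∀ l, 0 ≤ start l
  start_lt_finish : ∀ l, start l < finish l
  finish_le : ∀ l, finish l ≤ T
  disjoint : ∀ l l', l ≠ l' → ¬ Disjoint (qubits l) (qubits l') →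
    Disjoint (Set.Ico (start l) (finish l)) (Set.Ico (start l') (finish l'))
  gateHam : Loc → ℝ → (SystemSpace Q →L[ℂ] SystemSpace Q)
  gateHam_selfAdjoint : ∀ l t, IsSelfAdjoint (gateHam l t)
  gateHam_actsOn : ∀ l t, ActsOn (qubits l) (gateHam l t)

namespace Circuit

variable {Q Loc : Type*} [Fintype Q] [DecidableEq Q] (C : Circuit Q Loc)

/-- The time window during which the location `l` is executed. -/
def window (l : Loc) : Set ℝ := Set.Ico (C.start l) (C.finish l)

/-- The maximal duration `t₀` of any location. -/
def maxDuration : ℝ := ⨆ l, (C.finish l - C.start l)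

/-- The ideal system Hamiltonian `H_S(t)`: the sum of the Hamiltonians of the gates that are
being executed at time `t`. -/
def systemHam [Fintype Loc] (t : ℝ) : SystemSpace Q →L[ℂ] SystemSpace Q :=
  ∑ l, (C.window l).indicator (C.gateHam l) t

end Circuit

/-- A circuit coupled to a bath: the joint Hamiltonian is
`H = H_S + H_B + H_SB`, `H_SB = ∑_S term S`, where `term S` acts on the set `S` of qubits and
arbitrarily on the bath. The bath Hamiltonian is any self-adjoint, possibly unbounded and
time-dependent, operator that has a propagator. -/
structure NoiseModel (Q Loc B : Type*) [Fintype Q] [DecidableEq Q] [Fintype Loc]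
    [NormedAddCommGroup B] [InnerProductSpace ℂ B] [CompleteSpace B] extends Circuit Q Loc where
  /-- the evolution under `H_S` alone -/
  systemProp : ℝ → ℝ → (SystemSpace Q →L[ℂ] SystemSpace Q)
  systemProp_isPropagator :
    IsPropagator (fun t => (toCircuit.systemHam t).toLinearMap.toPMap ⊤) systemProp
  bathHam : ℝ → B →ₗ.[ℂ] B
  bathHam_selfAdjoint : ∀ t, IsSelfAdjoint (bathHam t)
  /-- the evolution under `H_B` alone -/
  bathProp : ℝ → ℝ → (B →L[ℂ] B)
  bathProp_isPropagator : IsPropagator bathHam bathProp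
  term : Finset Q → ℝ → (JointSpace Q B →L[ℂ] JointSpace Q B)
  term_empty : ∀ t, term ∅ t = 0
  term_selfAdjoint : ∀ S t, IsSelfAdjoint (term S t)
  term_actsOn : ∀ S t, ActsOn S (term S t)
  term_measurable : ∀ S ψ, StronglyMeasurable fun t => term S t ψ
  term_bounded : ∃ M : ℝ, ∀ S, ∀ t ∈ Set.Icc 0 T, ‖term S t‖ ≤ M

namespace NoiseModel

variable {Q Loc B : Type*} [Fintype Q] [DecidableEq Q] [Fintype Loc]
  [NormedAddCommGroup B] [InnerProductSpace ℂ B] [CompleteSpace B] (M : NoiseModel Q Loc B)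

/-- The term `H^{(k)}_{i_1, …, i_k}(t)` labelled by an ordered `k`-tuple of qubits: symmetric in
the indices, and zero if two of them coincide. -/
def tupleTerm {k : ℕ} (i : Fin k → Q) (t : ℝ) : JointSpace Q B →L[ℂ] JointSpace Q B :=
  open Classical in
  if Function.Injective i then M.term (Finset.univ.image i) t else 0

/-- `max_{i_1} ∑_{i_2, …, i_k} ‖H^{(k)}_{i_1, …, i_k}‖ t₀` for `k ≥ 1`, the maximum being over all
qubits and all times of the computation. -/
def eta (k : ℕ) : ℝ :=
  (⨆ q : Q × Set.Icc (0 : ℝ) M.T, ∑ r : Fin (k - 1) → Q,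
    ‖M.tupleTerm (Fin.cons q.1 r : Fin (k - 1 + 1) → Q) q.2‖) * M.maxDuration

/-- `α_p = max_{k ≥ 1} [ (k^p / k!) max_{i_1} ∑ ‖H^{(k)}‖ t₀ ]^{1/k}`. -/
def alpha (p : ℝ) : ℝ :=
  ⨆ k : ℕ+, (((k : ℕ) : ℝ) ^ p / ((k : ℕ).factorial : ℝ) * M.eta k) ^ (1 / ((k : ℕ) : ℝ))

/-- The joint evolution from time `s` to time `t` under `H_S + H_B`. -/
def freeProp (t s : ℝ) : JointSpace Q B →L[ℂ] JointSpace Q B :=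
  tensorOp (M.systemProp t s) (M.bathProp t s)

/-- The monomial in the expansion of the joint evolution from time `0` to time `s` in powers of
`H_SB` in which the terms labelled `a 0, a 1, …` act at the times `t 0, t 1, …`, in this order:
`U₀(s, t_{N-1}) (-i H_{a (N-1)}(t_{N-1})) ⋯ (-i H_{a 0}(t_0)) U₀(t_0, 0)`. -/
def monomial : (N : ℕ) → (Fin N → Finset Q) → (Fin N → ℝ) → ℝ →
    (JointSpace Q B →L[ℂ] JointSpace Q B)
  | 0, _, _, s => M.freeProp s 0
  | N + 1, a, t, s =>
      M.freeProp s (t (Fin.last N)) ∘L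
        ((-Complex.I) • M.term (a (Fin.last N)) (t (Fin.last N))) ∘L
          monomial N (Fin.init a) (Fin.init t) (t (Fin.last N))

/-- The location `l` is faulty in the history in which the terms `a j` act at the times `t j`: at
least one of its qubits is struck at least once by a term during the execution of `l`. -/
def Faulty (l : Loc) {N : ℕ} (a : Fin N → Finset Q) (t : Fin N → ℝ) : Prop :=
  ∃ j, t j ∈ M.window l ∧ (a j ∩ M.qubits l).Nonempty

/-- The time-ordered `N`-tuples of times in `[0, T]` for which every location in `I` is faulty. -/
def faultTimes (I : Finset Loc) {N : ℕ} (a : Fin N → Finset Q) : Set (Fin N → ℝ) :=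
  {t | Monotone t ∧ (∀ j, t j ∈ Set.Icc 0 M.T) ∧ ∀ l ∈ I, M.Faulty l a t}

/-- `E` is `E(I)`, the sum, to all orders, of all the terms in the expansion of the joint evolution
over `[0, T]` in powers of `H_SB` for which every location in `I` is faulty. The integrals over
time and the series are those of the vectors obtained by applying the operators to a state, and
they are required to converge. -/
def IsFaultOperator (I : Finset Loc) (E : JointSpace Q B →L[ℂ] JointSpace Q B) : Prop :=
  ∀ ψ : JointSpace Q B,
    (∀ (N : ℕ) (a : Fin N → Finset Q),
      IntegrableOn (fun t => M.monomial N a t M.T ψ) (M.faultTimes I a)) ∧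
    HasSum (fun N : ℕ => ∑ a : Fin N → Finset Q,
      ∫ t in M.faultTimes I a, M.monomial N a t M.T ψ) (E ψ)

/-- The noise has effective noise strength `ε`: `‖E(I)‖ ≤ ε ^ r` for every set `I` of `r`
circuit locations. -/
def HasEffectiveNoiseStrength (ε : ℝ) : Prop :=
  0 ≤ ε ∧ ∀ I : Finset Loc, ∃ E : JointSpace Q B →L[ℂ] JointSpace Q B,
    M.IsFaultOperator I E ∧ ‖E‖ ≤ ε ^ I.card

end NoiseModel

/-- `C(α) = (1 - 2α)⁻¹`. -/
def enhancement (α : ℝ) : ℝ := (1 - 2 * α)⁻¹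

/-- `2 m α exp (C(α) ∑_{k ≥ 1} 1 / (2 k^p))`. -/
def noiseBound (m : ℕ) (p α : ℝ) : ℝ :=
  2 * m * α * Real.exp (enhancement α * ∑' k : ℕ+, 1 / (2 * ((k : ℕ) : ℝ) ^ p))

end

/-!
In the interaction picture with respect to `H_S + H_B`, let `E R` be the sum of the terms of the
Dyson series which make every location of `R` faulty. Splitting a history off at its latest
interaction shows that `E R` has the time derivative `∑ V (E (R \ hit V))`, the sum being over the
generators `V`. The generators which hit no location of `R` contribute `V (E R)`, and since they are
skew-adjoint they do not increase the norm of `E R`. Hence `‖E R‖` is at most the time integral of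
the contributions of the other generators, which involve only smaller sets `R \ hit V`, and it can
be estimated by induction on `R`.

At a given time a term on `k` qubits strikes at most `k` locations. When it strikes `n ≥ 1`
locations of `R`, the bound `2 m α ^ k k ≤ n (2 m α) ^ n` lets each of them be treated as an
independent fault of weight `2 m α`, and the definition of `α` leaves to each location a total rate
whose integral over its window is at most `∑ k, 1 / (2 k ^ p)`. So each location costs at most
`2 m α exp (∑ k, 1 / (2 k ^ p))`, and `C(α) ≥ 1`.
-/

section Measurability

open TopologicalSpace

variable {X E F : Type*} [MeasurableSpace X] [TopologicalSpace F] [PseudoMetrizableSpace F]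

theorem stronglyMeasurable_select {ι : Type*} [Countable ι] {f : ι → X → F}
    (hf : ∀ i, StronglyMeasurable (f i)) {ρ : X → ι} (hρ : ∀ i, MeasurableSet (ρ ⁻¹' {i})) :
    StronglyMeasurable fun x => f (ρ x) x := by
  let _ : MeasurableSpace ι := ⊤
  let _ : TopologicalSpace ι := ⊥
  have : DiscreteTopology ι := ⟨rfl⟩
  exact (stronglyMeasurable_uncurry_of_continuous_of_stronglyMeasurable
    (fun _ => continuous_of_discreteTopology) hf).comp_measurable
      ((measurable_to_countable' hρ).prodMk measurable_id)

theorem stronglyMeasurable_comp_of_continuous [TopologicalSpace E] {f : X → E → F}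
    (hcont : ∀ x, Continuous (f x)) (hf : ∀ v, StronglyMeasurable fun x => f x v) {g : X → E}
    (hg : StronglyMeasurable g) : StronglyMeasurable fun x => f x (g x) := by
  refine stronglyMeasurable_of_tendsto atTop (f := fun n x => f x (hg.approx n x)) (fun n => ?_)
    (tendsto_pi_nhds.2 fun x => ((hcont x).tendsto _).comp (hg.tendsto_approx x))
  exact stronglyMeasurable_select (fun v : (hg.approx n).range => hf v)
    (ρ := fun x => ⟨_, (hg.approx n).mem_range_self x⟩)
    fun v => by simpa [Set.preimage, Subtype.ext_iff] using (hg.approx n).measurableSet_fiber v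

end Measurability

section AbsoluteContinuity

variable {a b : ℝ}

theorem absolutelyContinuousOnInterval_of_dist_le {X Y : Type*} [PseudoMetricSpace X]
    [PseudoMetricSpace Y] {f : ℝ → X} {g : ℝ → Y} {K : ℝ}
    (hg : AbsolutelyContinuousOnInterval g a b)
    (h : ∀ x ∈ Set.uIcc a b, ∀ y ∈ Set.uIcc a b, dist (f x) (f y) ≤ K * dist (g x) (g y)) :
    AbsolutelyContinuousOnInterval f a b := by
  refine squeeze_zero' (Eventually.of_forall fun E => Finset.sum_nonneg fun i _ => dist_nonneg)
    (Filter.Eventually.filter_mono inf_le_right <| eventually_principal.2 fun E hE =>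
      (Finset.sum_le_sum fun i hi => h _ (hE.1 i hi).1 _ (hE.1 i hi).2).trans_eq
        (Finset.mul_sum _ _ _).symm) ?_
  simpa using Tendsto.const_mul K hg

theorem intervalIntegrable_mul_exp_integral {k : ℝ → ℝ} (hk : IntervalIntegrable k volume a b) :
    IntervalIntegrable (fun τ => k τ * Real.exp (∫ σ in a..τ, k σ)) volume a b :=
  hk.mul_continuousOn (Real.continuous_exp.comp_continuousOn
    (hk.absolutelyContinuousOnInterval_intervalIntegral Set.left_mem_uIcc).continuousOn)

theorem integral_mul_exp_integral {k : ℝ → ℝ} (hk : IntervalIntegrable k volume a b) :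
    ∫ τ in a..b, k τ * Real.exp (∫ σ in a..τ, k σ) = Real.exp (∫ τ in a..b, k τ) - 1 := by
  set P : ℝ → ℝ := fun τ => ∫ σ in a..τ, k σ
  have hP : AbsolutelyContinuousOnInterval P a b :=
    hk.absolutelyContinuousOnInterval_intervalIntegral Set.left_mem_uIcc
  obtain ⟨R, hR⟩ := hP.exists_bound
  obtain ⟨K, hK⟩ := (Real.contDiff_exp.contDiffOn (n := 1)).exists_lipschitzOnWith one_ne_zero
    (convex_closedBall (0 : ℝ) R) (isCompact_closedBall 0 R)
  have hexp : AbsolutelyContinuousOnInterval (Real.exp ∘ P) a b :=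
    absolutelyContinuousOnInterval_of_dist_le hP fun x hx y hy =>
      hK.dist_le_mul _ (mem_closedBall_zero_iff.2 (hR x hx)) _ (mem_closedBall_zero_iff.2 (hR y hy))
  calc ∫ τ in a..b, k τ * Real.exp (P τ) = ∫ τ in a..b, deriv (Real.exp ∘ P) τ := by
        refine intervalIntegral.integral_congr_ae ?_
        filter_upwards [hk.ae_hasDerivAt_integral] with τ hτ hmem
        have hd := hτ (Set.uIoc_subset_uIcc hmem) a Set.left_mem_uIcc
        rw [((Real.hasDerivAt_exp _).comp τ hd).deriv, mul_comm]
    _ = Real.exp (P b) - 1 := by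
        rw [hexp.integral_deriv_eq_sub]
        simp [P]

end AbsoluteContinuity

section Energy

open scoped RealInnerProductSpace

variable {H : Type*} [NormedAddCommGroup H] [InnerProductSpace ℝ H]

theorem deriv_norm_le_of_inner_le {φ : ℝ → H} {φ' : H} {t g : ℝ} (hφ : HasDerivAt φ φ' t)
    (hg : 0 ≤ g) (h : ⟪φ t, φ'⟫ ≤ ‖φ t‖ * g) : deriv (fun τ => ‖φ τ‖) t ≤ g := by
  rcases eq_or_ne (φ t) 0 with h0 | h0
  · have hmin : IsLocalMin (fun τ => ‖φ τ‖) t := Eventually.of_forall fun τ => by simp [h0]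
    exact hmin.deriv_eq_zero.trans_le hg
  · have hd : DifferentiableAt ℝ (fun τ => ‖φ τ‖) t := hφ.differentiableAt.norm ℝ h0
    have heq : 2 * ‖φ t‖ * deriv (fun τ => ‖φ τ‖) t = 2 * ⟪φ t, φ'⟫ := by
      simpa using (hd.hasDerivAt.pow 2).unique hφ.norm_sq
    have hpos : 0 < ‖φ t‖ := norm_pos_iff.2 h0
    exact le_of_mul_le_mul_left (by linarith) hpos

theorem norm_add_integral_le_of_inner_le [CompleteSpace H] {u : ℝ → H} {g : ℝ → ℝ} {a b : ℝ}
    (hab : a ≤ b) (v : H) (hu : IntervalIntegrable u volume a b)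
    (hg : IntervalIntegrable g volume a b) (hg0 : ∀ t ∈ Set.Icc a b, 0 ≤ g t)
    (h : ∀ t ∈ Set.Icc a b,
      ⟪v + ∫ τ in a..t, u τ, u t⟫ ≤ ‖v + ∫ τ in a..t, u τ‖ * g t) :
    ‖v + ∫ t in a..b, u t‖ ≤ ‖v‖ + ∫ t in a..b, g t := by
  set φ : ℝ → H := fun t => v + ∫ τ in a..t, u τ
  have hac : AbsolutelyContinuousOnInterval (fun t => ‖φ t‖) a b := by
    refine absolutelyContinuousOnInterval_of_dist_le (K := 1)
      (hu.norm.absolutelyContinuousOnInterval_intervalIntegral Set.left_mem_uIcc) ?_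
    intro x hx y hy
    have hux := hu.mono_set (Set.uIcc_subset_uIcc_left hx)
    have huy := hu.mono_set (Set.uIcc_subset_uIcc_left hy)
    calc dist ‖φ x‖ ‖φ y‖ ≤ ‖φ x - φ y‖ := (dist_norm_norm_le _ _)
      _ = ‖∫ τ in y..x, u τ‖ := by
        simp only [φ, add_sub_add_left_eq_sub, intervalIntegral.integral_interval_sub_left hux huy]
      _ ≤ |∫ τ in y..x, ‖u τ‖| := intervalIntegral.norm_integral_le_abs_integral_norm
      _ = 1 * dist (∫ τ in a..x, ‖u τ‖) (∫ τ in a..y, ‖u τ‖) := by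
        rw [one_mul, Real.dist_eq,
          intervalIntegral.integral_interval_sub_left hux.norm huy.norm]
  have hderiv : deriv (fun t => ‖φ t‖) ≤ᵐ[volume.restrict (Set.Icc a b)] g := by
    refine (ae_restrict_iff' measurableSet_Icc).2 ?_
    filter_upwards [hu.ae_hasDerivAt_integral] with t ht hmem
    have hφ : HasDerivAt φ (u t) t :=
      (ht (Set.Icc_subset_uIcc hmem) a Set.left_mem_uIcc).const_add v
    exact deriv_norm_le_of_inner_le hφ (hg0 t hmem) (h t hmem)
  have hle := intervalIntegral.integral_mono_ae_restrict hab hac.intervalIntegrable_deriv hg hderiv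
  rw [hac.integral_deriv_eq_sub] at hle
  have hφa : φ a = v := by simp [φ]
  rw [hφa] at hle
  linarith

end Energy

section Snoc

theorem monotone_snoc_iff {N : ℕ} {α : Type*} [Preorder α] {t : Fin N → α} {τ : α} :
    Monotone (Fin.snoc t τ : Fin (N + 1) → α) ↔ Monotone t ∧ ∀ j, t j ≤ τ := by
  simpa [Monotone, Fin.forall_fin_succ', forall_and] using
    fun _ => ⟨fun h j => h j (Fin.le_last _), fun h j _ => h j⟩

theorem integral_eq_integral_integral_snoc {E : Type*} [NormedAddCommGroup E] [NormedSpace ℝ E]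
    {N : ℕ} {f : (Fin (N + 1) → ℝ) → E} (hf : Integrable f) :
    ∫ t, f t = ∫ τ, ∫ t : Fin N → ℝ, f (Fin.snoc t τ) := by
  have mp := (volume_preserving_piFinSuccAbove (fun _ : Fin (N + 1) => ℝ) (Fin.last N)).symm
  have hsnoc (q : ℝ × (Fin N → ℝ)) :
      (MeasurableEquiv.piFinSuccAbove (fun _ => ℝ) (Fin.last N)).symm q = Fin.snoc q.2 q.1 :=
    Fin.insertNth_last' _ _
  have hint := (mp.integrable_comp_emb (MeasurableEquiv.measurableEmbedding _)).2 hf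
  rw [← mp.integral_comp (MeasurableEquiv.measurableEmbedding _)]
  refine (integral_prod _ hint).trans ?_
  simp only [Function.comp_apply, hsnoc]

end Snoc

open NNReal in
/-- A bounded family of time-dependent generators `op a`, where `op a` hits the labels in
`hit a t` when it acts at time `t`. It stands for the perturbation in an evolution equation
`v' = ∑ a, op a t v`, so the factor `-i` of quantum mechanics is part of `op`. -/
structure MarkedGenerators (A L E : Type*) [NormedAddCommGroup E] [NormedSpace ℂ E] where
  op : A → ℝ → E →L[ℂ] E
  hit : A → ℝ → Finset L
  bound : ℝ≥0
  stronglyMeasurable_op : ∀ a v, StronglyMeasurable fun t => op a t v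
  norm_op_le : ∀ a t, ‖op a t‖ ≤ bound
  measurableSet_hit : ∀ a l, MeasurableSet {t | l ∈ hit a t}

namespace MarkedGenerators

variable {A L E : Type*} [NormedAddCommGroup E] [NormedSpace ℂ E] (G : MarkedGenerators A L E)

/-- The time-ordered product in which the generators `a 0, a 1, …` act at the times `t 0, t 1, …`,
the last one being leftmost. -/
def word : (N : ℕ) → (Fin N → A) → (Fin N → ℝ) → (E →L[ℂ] E)
  | 0, _, _ => 1
  | N + 1, a, t => G.op (a (Fin.last N)) (t (Fin.last N)) ∘L word N (Fin.init a) (Fin.init t)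

/-- The ordered tuples of times in `[0, s]` at which the generators `a 0, a 1, …` together hit
every label in `R`. -/
def times (R : Finset L) {N : ℕ} (a : Fin N → A) (s : ℝ) : Set (Fin N → ℝ) :=
  {t | Monotone t ∧ (∀ j, t j ∈ Set.Icc 0 s) ∧ ∀ l ∈ R, ∃ j, l ∈ G.hit (a j) (t j)}

/-- The contribution of the sequence of generators `a` to the Dyson series on `[0, s]` restricted
to the times at which every label in `R` is hit. -/
noncomputable def part {N : ℕ} (a : Fin N → A) (R : Finset L) (s : ℝ) (v : E) : E :=
  ∫ t in G.times R a s, G.word N a t v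

theorem norm_op_apply_le (a : A) (t : ℝ) (v : E) : ‖G.op a t v‖ ≤ G.bound * ‖v‖ :=
  (G.op a t).le_of_opNorm_le (G.norm_op_le a t) v

theorem stronglyMeasurable_op_comp (a : A) {f : ℝ → E} (hf : StronglyMeasurable f) :
    StronglyMeasurable fun t => G.op a t (f t) :=
  stronglyMeasurable_comp_of_continuous (fun t => (G.op a t).continuous)
    (G.stronglyMeasurable_op a) hf

theorem stronglyMeasurable_word (v : E) :
    ∀ (N : ℕ) (a : Fin N → A), StronglyMeasurable fun t => G.word N a t v
  | 0, _ => stronglyMeasurable_const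
  | N + 1, a =>
    stronglyMeasurable_comp_of_continuous (f := fun t : Fin (N + 1) → ℝ => G.op _ (t (Fin.last N)))
      (fun _ => ContinuousLinearMap.continuous _)
      (fun w => (G.stronglyMeasurable_op _ w).comp_measurable (measurable_pi_apply _))
      ((stronglyMeasurable_word v N (Fin.init a)).comp_measurable
        (measurable_pi_lambda _ fun _ => measurable_pi_apply _))

theorem norm_word_le (v : E) :
    ∀ (N : ℕ) (a : Fin N → A) (t : Fin N → ℝ), ‖G.word N a t v‖ ≤ G.bound ^ N * ‖v‖
  | 0, _, _ => by simp [word]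
  | N + 1, a, t => by
    calc ‖G.word (N + 1) a t v‖ ≤ G.bound * ‖G.word N (Fin.init a) (Fin.init t) v‖ :=
          G.norm_op_apply_le _ _ _
      _ ≤ G.bound * (G.bound ^ N * ‖v‖) := by gcongr; exact norm_word_le v N _ _
      _ = G.bound ^ (N + 1) * ‖v‖ := by ring

theorem measurableSet_times_graph (R : Finset L) {N : ℕ} (a : Fin N → A) :
    MeasurableSet {q : ℝ × (Fin N → ℝ) | q.2 ∈ G.times R a q.1} := by
  have hcoord (j : Fin N) : Measurable fun q : ℝ × (Fin N → ℝ) => q.2 j :=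
    (measurable_pi_apply j).comp measurable_snd
  have hinter : {q : ℝ × (Fin N → ℝ) | q.2 ∈ G.times R a q.1} = {q | Monotone q.2} ∩
      ((⋂ j, {q | 0 ≤ q.2 j} ∩ {q | q.2 j ≤ q.1}) ∩
        ⋂ l ∈ R, ⋃ j, (fun q => q.2 j) ⁻¹' {t | l ∈ G.hit (a j) t}) := by
    ext q
    simp [times]
  rw [hinter]
  refine (measurable_snd isClosed_monotone.measurableSet).inter (.inter ?_ ?_)
  · exact .iInter fun j => (measurableSet_le measurable_const (hcoord j)).inter
      (measurableSet_le (hcoord j) measurable_fst)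
  · exact Finset.measurableSet_biInter _ fun l _ => .iUnion fun j =>
      hcoord j (G.measurableSet_hit (a j) l)

theorem measurableSet_times (R : Finset L) {N : ℕ} (a : Fin N → A) (s : ℝ) :
    MeasurableSet (G.times R a s) :=
  measurable_prodMk_left (G.measurableSet_times_graph R a)

theorem integrableOn_word (R : Finset L) {N : ℕ} (a : Fin N → A) (s : ℝ) (v : E) :
    IntegrableOn (fun t => G.word N a t v) (G.times R a s) := by
  have hsub : G.times R a s ⊆ Set.Icc (fun _ => 0) (fun _ => s) :=
    fun t ht => ⟨fun j => (ht.2.1 j).1, fun j => (ht.2.1 j).2⟩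
  exact Measure.integrableOn_of_bounded (M := G.bound ^ N * ‖v‖)
    (measure_ne_top_of_subset hsub isCompact_Icc.measure_lt_top.ne)
    (G.stronglyMeasurable_word v N a).aestronglyMeasurable
    (Eventually.of_forall fun t => G.norm_word_le v N a t)

theorem stronglyMeasurable_part (R : Finset L) {N : ℕ} (a : Fin N → A) (v : E) :
    StronglyMeasurable fun s => G.part a R s v := by
  have hind : StronglyMeasurable fun q : ℝ × (Fin N → ℝ) =>
      (G.times R a q.1).indicator (fun t => G.word N a t v) q.2 :=
    ((G.stronglyMeasurable_word v N a).comp_measurable measurable_snd).indicator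
      (G.measurableSet_times_graph R a)
  simpa only [part, ← integral_indicator (G.measurableSet_times R a _)] using
    hind.integral_prod_right'

theorem part_of_neg (R : Finset L) {N : ℕ} (a : Fin (N + 1) → A) {s : ℝ} (hs : s < 0) (v : E) :
    G.part a R s v = 0 := by
  have hempty : G.times R a s = ∅ := Set.eq_empty_of_forall_notMem fun t ht =>
    hs.not_ge ((ht.2.1 0).1.trans (ht.2.1 0).2)
  simp [part, hempty]

section Recursion

variable [CompleteSpace E]

theorem part_zero [DecidableEq L] (a : Fin 0 → A) (R : Finset L) (s : ℝ) (v : E) :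
    G.part a R s v = if R = ∅ then v else 0 := by
  have htimes : G.times R a s = if R = ∅ then Set.univ else ∅ := by
    ext t
    split_ifs with hR
    · simp [times, hR, Monotone]
    · simpa [times, Monotone, ← Finset.nonempty_def] using Finset.nonempty_iff_ne_empty.2 hR
  rw [part, htimes, Measure.volume_pi_eq_dirac]
  split_ifs <;> simp [word]

omit [CompleteSpace E] in
theorem snoc_mem_times_iff [DecidableEq L] {R : Finset L} {N : ℕ} {a : Fin (N + 1) → A}
    {s τ : ℝ} {t : Fin N → ℝ} : Fin.snoc t τ ∈ G.times R a s ↔ τ ∈ Set.Icc 0 s ∧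
      t ∈ G.times (R \ G.hit (a (Fin.last N)) τ) (Fin.init a) τ := by
  simp only [times, Set.mem_ofPred_eq, monotone_snoc_iff, Fin.forall_fin_succ', Fin.snoc_castSucc,
    Fin.snoc_last, Fin.exists_fin_succ', Fin.init, Finset.mem_sdiff, Set.mem_Icc]
  refine ⟨fun ⟨⟨hmono, hle⟩, ⟨hIcc, hτ⟩, hhit⟩ =>
      ⟨hτ, hmono, fun j => ⟨(hIcc j).1, hle j⟩, fun l hl => (hhit l hl.1).resolve_right hl.2⟩,
    fun ⟨hτ, hmono, hIcc, hhit⟩ => ⟨⟨hmono, fun j => (hIcc j).2⟩,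
      ⟨fun j => ⟨(hIcc j).1, (hIcc j).2.trans hτ.2⟩, hτ⟩, fun l hl => ?_⟩⟩
  exact or_iff_not_imp_right.2 fun hl' => hhit l ⟨hl, hl'⟩

theorem part_succ [DecidableEq L] {N : ℕ} (a : Fin (N + 1) → A) (R : Finset L) {s : ℝ}
    (hs : 0 ≤ s) (v : E) :
    G.part a R s v = ∫ τ in (0 : ℝ)..s, G.op (a (Fin.last N)) τ
      (G.part (Fin.init a) (R \ G.hit (a (Fin.last N)) τ) τ v) := by
  set b := a (Fin.last N)
  have hsnoc (τ : ℝ) (t : Fin N → ℝ) :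
      (G.times R a s).indicator (fun t => G.word (N + 1) a t v) (Fin.snoc t τ) =
        (Set.Icc 0 s).indicator (fun τ => (G.times (R \ G.hit b τ) (Fin.init a) τ).indicator
          (fun t => G.op b τ (G.word N (Fin.init a) t v)) t) τ := by
    by_cases hτ : τ ∈ Set.Icc 0 s <;>
      by_cases ht : t ∈ G.times (R \ G.hit b τ) (Fin.init a) τ <;>
        simp [Set.indicator, snoc_mem_times_iff, word, hτ, ht, b]
  rw [part, ← integral_indicator (G.measurableSet_times R a s), integral_eq_integral_integral_snoc
      ((G.integrableOn_word R a s v).integrable_indicator (G.measurableSet_times R a s)),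
    intervalIntegral.integral_of_le hs, ← integral_Icc_eq_integral_Ioc,
    ← integral_indicator measurableSet_Icc]
  congr 1 with τ
  by_cases hτ : τ ∈ Set.Icc 0 s
  · simp only [hsnoc, Set.indicator_of_mem hτ]
    rw [integral_indicator (G.measurableSet_times _ _ _),
      ContinuousLinearMap.integral_comp_comm _ (G.integrableOn_word _ _ _ _), part]
  · simp [hsnoc, Set.indicator_of_notMem hτ]

theorem norm_part_le (v : E) : ∀ {N : ℕ} (a : Fin N → A) (R : Finset L) (s : ℝ),
    ‖G.part a R s v‖ ≤ (G.bound * |s|) ^ N / N.factorial * ‖v‖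
  | 0, a, R, s => by
    classical
    rw [part_zero]
    split_ifs <;> simp
  | N + 1, a, R, s => by
    classical
    rcases lt_or_ge s 0 with hs | hs
    · rw [G.part_of_neg R a hs, norm_zero]
      positivity
    have hint : ∫ τ in (0 : ℝ)..s, G.bound * ((G.bound * τ) ^ N / N.factorial * ‖v‖) =
        (G.bound * s) ^ (N + 1) / (N + 1).factorial * ‖v‖ := by
      have hfact : (N.factorial : ℝ) ≠ 0 := by positivity
      simp only [mul_pow, intervalIntegral.integral_const_mul, intervalIntegral.integral_mul_const,
        intervalIntegral.integral_div, integral_pow, Nat.factorial_succ]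
      push_cast
      field_simp
      ring
    rw [abs_of_nonneg hs, G.part_succ a R hs, ← hint]
    refine intervalIntegral.norm_integral_le_of_norm_le hs (ae_of_all _ fun τ hτ => ?_)
      (Continuous.intervalIntegrable (by fun_prop) _ _)
    refine (G.norm_op_apply_le _ _ _).trans ?_
    gcongr
    simpa only [abs_of_pos hτ.1] using norm_part_le v (Fin.init a) _ τ

variable [DecidableEq L]

omit [CompleteSpace E] in
theorem stronglyMeasurable_op_sdiff [Countable L] (b : A) (R : Finset L) {f : Finset L → ℝ → E}
    (hf : ∀ R', StronglyMeasurable (f R')) :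
    StronglyMeasurable fun τ => G.op b τ (f (R \ G.hit b τ) τ) := by
  refine G.stronglyMeasurable_op_comp b (stronglyMeasurable_select hf fun R' => ?_)
  have hfiber : (fun τ => R \ G.hit b τ) ⁻¹' {R'} =
      {τ | ∀ l, (l ∈ R ∧ l ∉ G.hit b τ) ↔ l ∈ R'} := by
    ext τ
    simp [Finset.ext_iff]
  rw [hfiber, measurableSet_setOfPred]
  exact .forall fun l =>
    (measurable_const.and (measurableSet_setOfPred.1 (G.measurableSet_hit b l)).not).iff
      measurable_const

theorem intervalIntegrable_op_part [Countable L] {N : ℕ} (a : Fin N → A) (R : Finset L) (b : A)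
    (s : ℝ) (v : E) :
    IntervalIntegrable (fun τ => G.op b τ (G.part a (R \ G.hit b τ) τ v)) volume 0 s := by
  have hcont : Continuous fun τ : ℝ =>
      (G.bound : ℝ) * ((G.bound * |τ|) ^ N / N.factorial * ‖v‖) := by fun_prop
  refine (hcont.intervalIntegrable 0 s).mono_fun'
    (G.stronglyMeasurable_op_sdiff b R fun R' =>
      G.stronglyMeasurable_part R' a v).aestronglyMeasurable
    (ae_of_all _ fun τ => (G.norm_op_apply_le _ _ _).trans
      (mul_le_mul_of_nonneg_left (G.norm_part_le v a _ τ) G.bound.2))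

end Recursion

section Series

variable [Fintype A]

/-- The term of order `N` of the Dyson series on `[0, s]` restricted to the times at which every
label in `R` is hit. -/
noncomputable def order (N : ℕ) (R : Finset L) (s : ℝ) (v : E) : E :=
  ∑ a : Fin N → A, G.part a R s v

/-- The Dyson series on `[0, s]` restricted to the times at which every label in `R` is hit. -/
noncomputable def series (R : Finset L) (s : ℝ) (v : E) : E :=
  ∑' N, G.order N R s v

theorem stronglyMeasurable_order (N : ℕ) (R : Finset L) (v : E) :
    StronglyMeasurable fun s => G.order N R s v :=
  Finset.stronglyMeasurable_fun_sum _ fun a _ => G.stronglyMeasurable_part R a v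

theorem order_add (N : ℕ) (R : Finset L) (s : ℝ) (v w : E) :
    G.order N R s (v + w) = G.order N R s v + G.order N R s w := by
  simp only [order, part, map_add, ← Finset.sum_add_distrib]
  exact Finset.sum_congr rfl fun a _ =>
    integral_add (G.integrableOn_word R a s v) (G.integrableOn_word R a s w)

theorem order_smul (N : ℕ) (R : Finset L) (s : ℝ) (z : ℂ) (v : E) :
    G.order N R s (z • v) = z • G.order N R s v := by
  simp only [order, part, map_smul, integral_smul, Finset.smul_sum]

variable [CompleteSpace E]

theorem norm_order_le (N : ℕ) (R : Finset L) (s : ℝ) (v : E) :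
    ‖G.order N R s v‖ ≤ (Fintype.card A * (G.bound * |s|)) ^ N / N.factorial * ‖v‖ := by
  refine (norm_sum_le_of_le _ fun a _ => G.norm_part_le v a R s).trans_eq ?_
  simp [mul_pow (Fintype.card A : ℝ)]
  ring

theorem hasSum_series (R : Finset L) (s : ℝ) (v : E) :
    HasSum (fun N => G.order N R s v) (G.series R s v) :=
  (Summable.of_norm_bounded ((Real.summable_pow_div_factorial _).mul_right ‖v‖) fun N =>
    G.norm_order_le N R s v).hasSum

theorem norm_series_le_exp (R : Finset L) (s : ℝ) (v : E) :
    ‖G.series R s v‖ ≤ Real.exp (Fintype.card A * (G.bound * |s|)) * ‖v‖ := by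
  rw [Real.exp_eq_exp_ℝ]
  exact tsum_of_norm_bounded ((NormedSpace.expSeries_div_hasSum_exp _).mul_right ‖v‖) fun N =>
    G.norm_order_le N R s v

theorem stronglyMeasurable_series (R : Finset L) (v : E) :
    StronglyMeasurable fun s => G.series R s v :=
  stronglyMeasurable_of_tendsto atTop
    (fun n => Finset.stronglyMeasurable_fun_sum (Finset.range n) fun N _ =>
      G.stronglyMeasurable_order N R v)
    (tendsto_pi_nhds.2 fun s => (G.hasSum_series R s v).tendsto_sum_nat)

theorem exists_forall_apply_eq_series (R : Finset L) (s : ℝ) :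
    ∃ U : E →L[ℂ] E, ∀ v, U v = G.series R s v := by
  let U : E →ₗ[ℂ] E :=
    { toFun := G.series R s
      map_add' := fun v w => (G.hasSum_series R s (v + w)).unique <| by
        simpa only [order_add] using (G.hasSum_series R s v).add (G.hasSum_series R s w)
      map_smul' := fun z v => (G.hasSum_series R s (z • v)).unique <| by
        simpa only [order_smul, RingHom.id_apply] using (G.hasSum_series R s v).const_smul z }
  exact ⟨U.mkContinuous _ (G.norm_series_le_exp R s), fun v => rfl⟩

variable [DecidableEq L]

theorem order_zero (R : Finset L) (s : ℝ) (v : E) :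
    G.order 0 R s v = if R = ∅ then v else 0 := by
  simp [order, part_zero]

variable [Countable L]

theorem order_succ (N : ℕ) (R : Finset L) {s : ℝ} (hs : 0 ≤ s) (v : E) :
    G.order (N + 1) R s v =
      ∫ τ in (0 : ℝ)..s, ∑ b, G.op b τ (G.order N (R \ G.hit b τ) τ v) := by
  have hint (b : A) (a : Fin N → A) := G.intervalIntegrable_op_part a R b s v
  simp only [order, map_sum]
  rw [intervalIntegral.integral_finsetSum fun b _ => by
    simpa only [Finset.sum_fn] using IntervalIntegrable.sum Finset.univ fun a _ => hint b a]
  simp_rw [intervalIntegral.integral_finsetSum fun (a : Fin N → A) _ => hint _ a]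
  rw [← (Fin.snocEquiv fun _ : Fin (N + 1) => A).sum_comp, Fintype.sum_prod_type]
  refine Finset.sum_congr rfl fun b _ => Finset.sum_congr rfl fun a _ => ?_
  simp [G.part_succ _ R hs, Fin.snocEquiv]

theorem hasSum_order_succ (R : Finset L) {s : ℝ} (hs : 0 ≤ s) (v : E) :
    HasSum (fun N => G.order (N + 1) R s v)
      (∫ τ in (0 : ℝ)..s, ∑ b, G.op b τ (G.series (R \ G.hit b τ) τ v)) := by
  simp only [G.order_succ _ R hs v]
  refine intervalIntegral.hasSum_integral_of_dominated_convergence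
    (fun N _ => Fintype.card A *
      (G.bound * ((Fintype.card A * (G.bound * s)) ^ N / N.factorial * ‖v‖)))
    (fun N => ?_) (fun N => ae_of_all _ fun τ hτ => ?_)
    (ae_of_all _ fun τ _ =>
      (((Real.summable_pow_div_factorial _).mul_right _).mul_left _).mul_left _)
    intervalIntegrable_const
    (ae_of_all _ fun τ _ => hasSum_sum fun b _ => (G.op b τ).hasSum (G.hasSum_series _ τ v))
  · exact (Finset.stronglyMeasurable_fun_sum _ fun b _ =>
      G.stronglyMeasurable_op_sdiff b R fun R' =>
        G.stronglyMeasurable_order N R' v).aestronglyMeasurable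
  · rw [Set.uIoc_of_le hs] at hτ
    rw [← nsmul_eq_mul, ← Finset.card_univ (α := A), ← Finset.sum_const]
    refine norm_sum_le_of_le _ fun b _ => (G.norm_op_apply_le _ _ _).trans ?_
    have horder := G.norm_order_le N (R \ G.hit b τ) τ v
    rw [abs_of_pos hτ.1] at horder
    have hτs : τ ≤ s := hτ.2
    have hτ0 : 0 ≤ τ := hτ.1.le
    refine mul_le_mul_of_nonneg_left (horder.trans ?_) G.bound.2
    rw [Finset.card_univ]
    gcongr

theorem series_eq_add_integral (R : Finset L) {s : ℝ} (hs : 0 ≤ s) (v : E) :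
    G.series R s v = (if R = ∅ then v else 0) +
      ∫ τ in (0 : ℝ)..s, ∑ b, G.op b τ (G.series (R \ G.hit b τ) τ v) := by
  rw [← G.order_zero R s v, series, (G.hasSum_series R s v).summable.tsum_eq_zero_add,
    (G.hasSum_order_succ R hs v).tsum_eq]

theorem intervalIntegrable_op_series (R : Finset L) (b : A) (s : ℝ) (v : E) :
    IntervalIntegrable (fun τ => G.op b τ (G.series (R \ G.hit b τ) τ v)) volume 0 s := by
  have hcont : Continuous fun τ : ℝ =>
      (G.bound : ℝ) * (Real.exp (Fintype.card A * (G.bound * |τ|)) * ‖v‖) := by fun_prop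
  refine (hcont.intervalIntegrable 0 s).mono_fun'
    (G.stronglyMeasurable_op_sdiff b R fun R' =>
      G.stronglyMeasurable_series R' v).aestronglyMeasurable
    (ae_of_all _ fun τ => (G.norm_op_apply_le _ _ _).trans
      (mul_le_mul_of_nonneg_left (G.norm_series_le_exp _ τ v) G.bound.2))

end Series

section Dissipative

variable {H : Type*} [NormedAddCommGroup H] [InnerProductSpace ℂ H] [Fintype A] [DecidableEq L]
  (G : MarkedGenerators A L H)

theorem re_inner_sum_op_le (hdiss : ∀ a t v, (inner ℂ v (G.op a t v)).re ≤ 0) (f : Finset L → H)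
    (R : Finset L) (τ : ℝ) : (inner ℂ (f R) (∑ b, G.op b τ (f (R \ G.hit b τ)))).re ≤
      ‖f R‖ * ∑ b with ¬Disjoint R (G.hit b τ), ‖G.op b τ‖ * ‖f (R \ G.hit b τ)‖ := by
  have hmiss : ∑ b with Disjoint R (G.hit b τ),
      (inner ℂ (f R) (G.op b τ (f (R \ G.hit b τ)))).re ≤ 0 :=
    Finset.sum_nonpos fun b hb => by
      rw [Finset.sdiff_eq_self_of_disjoint (Finset.mem_filter.1 hb).2]
      exact hdiss b τ (f R)
  rw [inner_sum, Complex.re_sum,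
    ← Finset.sum_filter_add_sum_filter_not _ fun b => Disjoint R (G.hit b τ), Finset.mul_sum]
  refine (add_le_of_nonpos_left hmiss).trans (Finset.sum_le_sum fun b _ => ?_)
  refine (re_inner_le_norm (𝕜 := ℂ) _ _).trans ?_
  gcongr
  exact (G.op b τ).le_opNorm _

theorem sum_norm_op_mul_norm_le {f : Finset L → H} {R : Finset L} {τ w c K : ℝ}
    (hdom : ∑ b with ¬Disjoint R (G.hit b τ), ‖G.op b τ‖ * w ^ (R \ G.hit b τ).card ≤
      w ^ R.card * K) (hc : 0 ≤ c) (hf : ∀ R' ⊂ R, ‖f R'‖ ≤ w ^ R'.card * c) :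
    ∑ b with ¬Disjoint R (G.hit b τ), ‖G.op b τ‖ * ‖f (R \ G.hit b τ)‖ ≤ w ^ R.card * K * c := by
  refine le_trans ?_ (mul_le_mul_of_nonneg_right hdom hc)
  rw [Finset.sum_mul]
  refine Finset.sum_le_sum fun b hb => ?_
  have hssub : R \ G.hit b τ ⊂ R := Finset.sdiff_subset.ssubset_of_ne fun h =>
    (Finset.mem_filter.1 hb).2 (Finset.sdiff_eq_self_iff_disjoint.1 h)
  rw [mul_assoc]
  gcongr
  exact hf _ hssub

variable [Countable L] [CompleteSpace H]

theorem norm_series_le (hdiss : ∀ a t v, (inner ℂ v (G.op a t v)).re ≤ 0) {k : L → ℝ → ℝ}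
    {w T : ℝ} (hw : 0 ≤ w) (hk : ∀ l s, IntervalIntegrable (k l) volume 0 s)
    (hk0 : ∀ l τ, 0 ≤ k l τ)
    (hdom : ∀ R, ∀ τ ∈ Set.Icc 0 T,
      ∑ b with ¬Disjoint R (G.hit b τ), ‖G.op b τ‖ * w ^ (R \ G.hit b τ).card ≤
        w ^ R.card * ∑ l ∈ R, k l τ) (v : H) (R : Finset L) :
    ∀ s ∈ Set.Icc 0 T, ‖G.series R s v‖ ≤
      w ^ R.card * Real.exp (∫ τ in 0..s, ∑ l ∈ R, k l τ) * ‖v‖ := by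
  have hkR (R : Finset L) (s : ℝ) : IntervalIntegrable (fun τ => ∑ l ∈ R, k l τ) volume 0 s := by
    simpa only [Finset.sum_fn] using IntervalIntegrable.sum R fun l _ => hk l s
  have hk0R (R : Finset L) (τ : ℝ) : 0 ≤ ∑ l ∈ R, k l τ := Finset.sum_nonneg fun l _ => hk0 l τ
  induction R using Finset.strongInduction with
  | H R ih =>
    intro s hs
    set P : ℝ → ℝ := fun τ => ∫ σ in 0..τ, ∑ l ∈ R, k l σ
    have hsub (τ : ℝ) (hτ : τ ∈ Set.Icc 0 T) (R' : Finset L) (hR' : R' ⊂ R) :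
        ‖G.series R' τ v‖ ≤ w ^ R'.card * (Real.exp (P τ) * ‖v‖) := by
      refine (ih R' hR' τ hτ).trans ?_
      rw [mul_assoc]
      gcongr
      exact intervalIntegral.integral_mono_on hτ.1 (hkR R' τ) (hkR R τ) fun σ _ =>
        Finset.sum_le_sum_of_subset_of_nonneg hR'.1 fun l _ _ => hk0 l σ
    let _ := InnerProductSpace.rclikeToReal ℂ H
    have henergy := norm_add_integral_le_of_inner_le hs.1 (if R = ∅ then v else 0)
      (u := fun τ => ∑ b, G.op b τ (G.series (R \ G.hit b τ) τ v))
      (g := fun τ => w ^ R.card * ‖v‖ * ((∑ l ∈ R, k l τ) * Real.exp (P τ)))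
      (by simpa only [Finset.sum_fn] using
        IntervalIntegrable.sum Finset.univ fun b _ => G.intervalIntegrable_op_series R b s v)
      ((intervalIntegrable_mul_exp_integral (hkR R s)).const_mul _)
      (fun τ _ => by have := hk0R R τ; positivity)
      (fun τ hτ => by
        have hτT : τ ∈ Set.Icc 0 T := ⟨hτ.1, hτ.2.trans hs.2⟩
        rw [← G.series_eq_add_integral R hτ.1 v]
        refine (G.re_inner_sum_op_le hdiss (fun R' => G.series R' τ v) R τ).trans
          (mul_le_mul_of_nonneg_left ?_ (norm_nonneg _))
        refine (G.sum_norm_op_mul_norm_le (hdom R τ hτT) (by positivity) (hsub τ hτT)).trans_eq ?_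
        ring)
    rw [← G.series_eq_add_integral R hs.1 v, intervalIntegral.integral_const_mul,
      integral_mul_exp_integral (hkR R s)] at henergy
    have hinit : ‖if R = ∅ then v else 0‖ ≤ w ^ R.card * ‖v‖ := by
      split_ifs with hR
      · simp [hR]
      · simpa using by positivity
    linarith

end Dissipative

end MarkedGenerators

section Tensor

variable {Q B : Type*} [Fintype Q] [DecidableEq Q] [NormedAddCommGroup B] [InnerProductSpace ℂ B]

theorem tensorOp_apply (A : SystemSpace Q →L[ℂ] SystemSpace Q) (V : B →L[ℂ] B)
    (ψ : JointSpace Q B) (x : Q → Fin 2) :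
    tensorOp A V ψ x = ∑ y : Q → Fin 2, A (PiLp.single 2 y (1 : ℂ)) x • V (ψ y) := by
  simp [tensorOp]

theorem systemOp_apply (A : SystemSpace Q →L[ℂ] SystemSpace Q) (ψ : SystemSpace Q)
    (x : Q → Fin 2) : A ψ x = ∑ y : Q → Fin 2, ψ y * A (PiLp.single 2 y (1 : ℂ)) x := by
  have hψ : ψ = ∑ y, ψ y • PiLp.single 2 y (1 : ℂ) := by
    ext z
    simp [Pi.single_apply]
  conv_lhs => rw [hψ]
  simp

theorem tensorOp_comp_tensorOp (A A' : SystemSpace Q →L[ℂ] SystemSpace Q) (V V' : B →L[ℂ] B) :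
    tensorOp A V ∘L tensorOp A' V' = tensorOp (A ∘L A') (V ∘L V') := by
  ext ψ x
  simp only [ContinuousLinearMap.comp_apply, tensorOp_apply, map_sum, map_smul,
    systemOp_apply A (A' _), Finset.smul_sum, Finset.sum_smul]
  rw [Finset.sum_comm]
  refine Finset.sum_congr rfl fun y _ => Finset.sum_congr rfl fun z _ => ?_
  rw [smul_smul, mul_comm]

theorem tensorOp_one : tensorOp (1 : SystemSpace Q →L[ℂ] SystemSpace Q) (1 : B →L[ℂ] B) = 1 := by
  ext ψ x
  simp [tensorOp_apply, PiLp.single_apply]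

theorem continuous_tensorOp_apply {X : Type*} [TopologicalSpace X]
    {A : X → SystemSpace Q →L[ℂ] SystemSpace Q} {V : X → B →L[ℂ] B}
    (hA : ∀ ψ, Continuous fun x => A x ψ) (hV : ∀ ψ, Continuous fun x => V x ψ)
    (ψ : JointSpace Q B) : Continuous fun x => tensorOp (A x) (V x) ψ := by
  refine (PiLp.homeomorph 2 fun _ : Q → Fin 2 => B).isInducing.continuous_iff.2
    (continuous_pi fun x => ?_)
  change Continuous fun q => tensorOp (A q) (V q) ψ x
  simp only [tensorOp_apply]
  exact continuous_finsetSum _ fun y _ => ((PiLp.continuous_apply 2 _ x).comp (hA _)).smul (hV _)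

theorem adjoint_tensorOp [CompleteSpace B] (A : SystemSpace Q →L[ℂ] SystemSpace Q)
    (V : B →L[ℂ] B) :
    (tensorOp A V).adjoint = tensorOp A.adjoint V.adjoint := by
  refine ((ContinuousLinearMap.eq_adjoint_iff _ _).2 fun ψ φ => ?_).symm
  have hA (x y : Q → Fin 2) : A.adjoint (PiLp.single 2 y (1 : ℂ)) x =
      (starRingEnd ℂ) (A (PiLp.single 2 x (1 : ℂ)) y) := by
    have hinner := A.adjoint_inner_left (PiLp.single 2 x (1 : ℂ)) (PiLp.single 2 y (1 : ℂ))
    simp only [PiLp.inner_apply, PiLp.single_apply] at hinner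
    apply (starRingEnd ℂ).injective
    simpa using hinner
  simp only [PiLp.inner_apply, tensorOp_apply, sum_inner, inner_sum, inner_smul_left,
    inner_smul_right, ContinuousLinearMap.adjoint_inner_left, hA, Complex.conj_conj]
  exact Finset.sum_comm

end Tensor

theorem IsPropagator.adjoint_eq {E : Type*} [NormedAddCommGroup E] [InnerProductSpace ℂ E]
    [CompleteSpace E] {H : ℝ → E →ₗ.[ℂ] E} {U : ℝ → ℝ → E →L[ℂ] E} (hU : IsPropagator H U)
    (t s : ℝ) : (U t s).adjoint = U s t :=
  left_inv_eq_right_inv (M := E →L[ℂ] E) (Unitary.mem_iff.1 (hU.unitary t s)).1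
    ((hU.comp t s t).trans (hU.self t))

theorem re_inner_neg_I_smul_eq_zero {E : Type*} [NormedAddCommGroup E] [InnerProductSpace ℂ E]
    [CompleteSpace E] {A : E →L[ℂ] E} (hA : IsSelfAdjoint A) (v : E) :
    (inner ℂ v (((-Complex.I) • A) v)).re = 0 := by
  have him := hA.isSymmetric.im_inner_self_apply v
  simpa [inner_smul_right] using him

namespace NoiseModel

variable {Q Loc B : Type*} [Fintype Q] [DecidableEq Q] [Fintype Loc]
  [NormedAddCommGroup B] [InnerProductSpace ℂ B] [CompleteSpace B] (M : NoiseModel Q Loc B)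

theorem freeProp_comp (t s r : ℝ) : M.freeProp t s ∘L M.freeProp s r = M.freeProp t r := by
  simp only [freeProp, tensorOp_comp_tensorOp, M.systemProp_isPropagator.comp,
    M.bathProp_isPropagator.comp]

theorem freeProp_self (t : ℝ) : M.freeProp t t = 1 := by
  rw [freeProp, M.systemProp_isPropagator.self, M.bathProp_isPropagator.self, tensorOp_one]

theorem adjoint_freeProp (t s : ℝ) : (M.freeProp t s).adjoint = M.freeProp s t := by
  simp only [freeProp, adjoint_tensorOp, M.systemProp_isPropagator.adjoint_eq,
    M.bathProp_isPropagator.adjoint_eq]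

theorem norm_freeProp_apply (t s : ℝ) (ψ : JointSpace Q B) : ‖M.freeProp t s ψ‖ = ‖ψ‖ := by
  refine (ContinuousLinearMap.norm_map_iff_adjoint_comp_self _).2 ?_ ψ
  rw [adjoint_freeProp, freeProp_comp, freeProp_self]

theorem continuous_freeProp_apply (ψ : JointSpace Q B) :
    Continuous fun q : ℝ × ℝ => M.freeProp q.1 q.2 ψ :=
  continuous_tensorOp_apply M.systemProp_isPropagator.continuous
    M.bathProp_isPropagator.continuous ψ

/-- The term labelled `S` in the interaction picture, cut off outside `[0, T]`, where nothing is
assumed about the norms of the terms. -/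
noncomputable def interactionTerm (S : Finset Q) : ℝ → JointSpace Q B →L[ℂ] JointSpace Q B :=
  (Set.Icc 0 M.T).indicator fun t => M.freeProp 0 t ∘L M.term S t ∘L M.freeProp t 0

theorem interactionTerm_of_mem (S : Finset Q) {t : ℝ} (ht : t ∈ Set.Icc 0 M.T) :
    M.interactionTerm S t = M.freeProp 0 t ∘L M.term S t ∘L M.freeProp t 0 :=
  Set.indicator_of_mem ht _

theorem interactionTerm_of_notMem (S : Finset Q) {t : ℝ} (ht : t ∉ Set.Icc 0 M.T) :
    M.interactionTerm S t = 0 :=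
  Set.indicator_of_notMem ht _

theorem stronglyMeasurable_interactionTerm (S : Finset Q) (ψ : JointSpace Q B) :
    StronglyMeasurable fun t => M.interactionTerm S t ψ := by
  have hfree (φ : JointSpace Q B) :
      StronglyMeasurable (fun t => M.freeProp t 0 φ) ∧
        StronglyMeasurable fun t => M.freeProp 0 t φ :=
    ⟨((M.continuous_freeProp_apply φ).comp (.prodMk_left 0)).stronglyMeasurable,
      ((M.continuous_freeProp_apply φ).comp (.prodMk_right 0)).stronglyMeasurable⟩
  have hterm := stronglyMeasurable_comp_of_continuous
    (fun t => (M.term S t).continuous) (M.term_measurable S) (hfree ψ).1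
  have hinter := stronglyMeasurable_comp_of_continuous
    (fun t => (M.freeProp 0 t).continuous) (fun φ => (hfree φ).2) hterm
  convert hinter.indicator (measurableSet_Icc (a := 0) (b := M.T)) using 2 with t
  by_cases ht : t ∈ Set.Icc 0 M.T <;> simp [interactionTerm, ht]

theorem norm_interactionTerm_le (S : Finset Q) {t : ℝ} (ht : t ∈ Set.Icc 0 M.T) :
    ‖M.interactionTerm S t‖ ≤ ‖M.term S t‖ := by
  rw [M.interactionTerm_of_mem S ht]
  refine ContinuousLinearMap.opNorm_le_bound _ (norm_nonneg _) fun ψ => ?_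
  simpa only [ContinuousLinearMap.comp_apply, norm_freeProp_apply] using
    (M.term S t).le_opNorm (M.freeProp t 0 ψ)

theorem isSelfAdjoint_interactionTerm (S : Finset Q) (t : ℝ) :
    IsSelfAdjoint (M.interactionTerm S t) := by
  by_cases ht : t ∈ Set.Icc 0 M.T
  · have hadj : M.freeProp 0 t = (M.freeProp t 0).adjoint := (M.adjoint_freeProp t 0).symm
    rw [M.interactionTerm_of_mem S ht, hadj]
    exact (M.term_selfAdjoint S t).adjoint_conj _
  · rw [M.interactionTerm_of_notMem S ht]
    exact .zero (JointSpace Q B →L[ℂ] JointSpace Q B)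

theorem exists_norm_interactionTerm_le :
    ∃ c : NNReal, ∀ S t, ‖M.interactionTerm S t‖ ≤ c := by
  obtain ⟨c, hc⟩ := M.term_bounded
  refine ⟨c.toNNReal, fun S t => ?_⟩
  by_cases ht : t ∈ Set.Icc 0 M.T
  · exact (M.norm_interactionTerm_le S ht).trans ((hc S t ht).trans c.le_coe_toNNReal)
  · simp [M.interactionTerm_of_notMem S ht]

open Classical in
/-- The locations struck by a term on `S` at time `t`. -/
noncomputable def struck (S : Finset Q) (t : ℝ) : Finset Loc :=
  {l | t ∈ M.window l ∧ (S ∩ M.qubits l).Nonempty}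

theorem mem_struck {S : Finset Q} {t : ℝ} {l : Loc} :
    l ∈ M.struck S t ↔ t ∈ M.window l ∧ (S ∩ M.qubits l).Nonempty := by
  simp [struck]

theorem measurableSet_struck (S : Finset Q) (l : Loc) : MeasurableSet {t | l ∈ M.struck S t} := by
  simp only [mem_struck]
  exact measurableSet_Ico.inter (.const _)

/-- The interaction picture of the noise: the terms, labelled by the sets of qubits on which they
act, generate the evolution relative to `H_S + H_B`, and they hit the locations which they make
faulty. -/
noncomputable def generators : MarkedGenerators (Finset Q) Loc (JointSpace Q B) where
  op S t := (-Complex.I) • M.interactionTerm S t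
  hit := M.struck
  bound := M.exists_norm_interactionTerm_le.choose
  stronglyMeasurable_op S ψ := (M.stronglyMeasurable_interactionTerm S ψ).const_smul (-Complex.I)
  norm_op_le S t := by
    simpa [norm_smul] using M.exists_norm_interactionTerm_le.choose_spec S t
  measurableSet_hit := M.measurableSet_struck

theorem monomial_eq_freeProp_comp_word {N : ℕ} (a : Fin N → Finset Q) {t : Fin N → ℝ}
    (ht : ∀ j, t j ∈ Set.Icc 0 M.T) (s : ℝ) :
    M.monomial N a t s = M.freeProp s 0 ∘L M.generators.word N a t := by
  induction N generalizing s with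
  | zero => rfl
  | succ N ih =>
    have hcancel (φ : JointSpace Q B) : M.freeProp s (t (Fin.last N)) φ =
        M.freeProp s 0 (M.freeProp 0 (t (Fin.last N)) φ) := by
      rw [← ContinuousLinearMap.comp_apply, freeProp_comp]
    have hop : M.generators.op (a (Fin.last N)) (t (Fin.last N)) = (-Complex.I) •
        (M.freeProp 0 (t (Fin.last N)) ∘L M.term (a (Fin.last N)) (t (Fin.last N)) ∘L
          M.freeProp (t (Fin.last N)) 0) :=
      congrArg ((-Complex.I) • ·) (M.interactionTerm_of_mem _ (ht (Fin.last N)))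
    rw [monomial, ih (Fin.init a) (t := Fin.init t) (fun j => ht j.castSucc),
      MarkedGenerators.word, hop]
    ext1 ψ
    simp [hcancel]

theorem faultTimes_eq_times (I : Finset Loc) {N : ℕ} (a : Fin N → Finset Q) :
    M.faultTimes I a = M.generators.times I a M.T := by
  ext t
  simp [faultTimes, MarkedGenerators.times, Faulty, generators, mem_struck]

theorem exists_isFaultOperator (I : Finset Loc) : ∃ E, M.IsFaultOperator I E ∧
    ∀ ψ, ‖E ψ‖ = ‖M.generators.series I M.T ψ‖ := by
  set G := M.generators
  obtain ⟨U, hU⟩ := G.exists_forall_apply_eq_series I M.T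
  have hmon (ψ : JointSpace Q B) {N : ℕ} (a : Fin N → Finset Q) : ∀ t ∈ G.times I a M.T,
      M.monomial N a t M.T ψ = M.freeProp M.T 0 (G.word N a t ψ) := fun t ht => by
    rw [M.monomial_eq_freeProp_comp_word a ht.2.1, ContinuousLinearMap.comp_apply]
  refine ⟨M.freeProp M.T 0 ∘L U, fun ψ => ⟨fun N a => ?_, ?_⟩, fun ψ => ?_⟩
  · rw [faultTimes_eq_times]
    exact IntegrableOn.congr_fun
      ((M.freeProp M.T 0).integrable_comp (G.integrableOn_word I a M.T ψ))
      (fun t ht => (hmon ψ a t ht).symm) (G.measurableSet_times I a M.T)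
  · rw [ContinuousLinearMap.comp_apply, hU]
    refine ((M.freeProp M.T 0).hasSum (G.hasSum_series I M.T ψ)).congr_fun fun N => ?_
    rw [MarkedGenerators.order, map_sum]
    refine Finset.sum_congr rfl fun a _ => ?_
    rw [faultTimes_eq_times, setIntegral_congr_fun (G.measurableSet_times I a M.T) (hmon ψ a),
      ContinuousLinearMap.integral_comp_comm _ (G.integrableOn_word I a M.T ψ),
      MarkedGenerators.part]
  · rw [ContinuousLinearMap.comp_apply, norm_freeProp_apply, hU]

theorem re_inner_generators_op (S : Finset Q) (t : ℝ) (ψ : JointSpace Q B) :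
    (inner ℂ ψ (M.generators.op S t ψ)).re = 0 :=
  re_inner_neg_I_smul_eq_zero (M.isSelfAdjoint_interactionTerm S t) ψ

theorem norm_generators_op_le (S : Finset Q) {t : ℝ} (ht : t ∈ Set.Icc 0 M.T) :
    ‖M.generators.op S t‖ ≤ ‖M.term S t‖ := by
  simpa [generators, norm_smul] using M.norm_interactionTerm_le S ht

end NoiseModel

section Series

/-- The exponent `∑ k ≥ 1, 1 / (2 k ^ p)` of `noiseBound`, half of `ζ(p)`. -/
noncomputable def halfZeta (p : ℝ) : ℝ :=
  ∑' k : ℕ+, 1 / (2 * ((k : ℕ) : ℝ) ^ p)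

variable {p : ℝ}

theorem summable_one_div_two_mul_rpow (hp : 1 < p) :
    Summable fun k : ℕ+ => 1 / (2 * ((k : ℕ) : ℝ) ^ p) :=
  (((Real.summable_one_div_nat_rpow.2 hp).comp_injective PNat.coe_injective).mul_left
    (1 / 2)).congr fun _ => one_div_mul_one_div _ _

theorem halfZeta_nonneg (p : ℝ) : 0 ≤ halfZeta p :=
  tsum_nonneg fun k => by positivity

theorem sum_range_le_halfZeta (hp : 1 < p) (n : ℕ) :
    ∑ k ∈ Finset.range n, 1 / (2 * ((k + 1 : ℕ) : ℝ) ^ p) ≤ halfZeta p := by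
  rw [halfZeta, tsum_pnat_eq_tsum_succ (f := fun k : ℕ => 1 / (2 * (k : ℝ) ^ p))]
  exact ((summable_pnat_iff_summable_succ (f := fun k : ℕ => 1 / (2 * (k : ℝ) ^ p))).1
    (summable_one_div_two_mul_rpow hp)).sum_le_tsum _ fun k _ => by positivity

theorem halfZeta_two : halfZeta 2 = Real.pi ^ 2 / 12 := by
  have hzeta := ((hasSum_nat_add_iff' 1).2 hasSum_zeta_two).mul_left (1 / 2)
  rw [halfZeta, tsum_pnat_eq_tsum_succ (f := fun k : ℕ => 1 / (2 * (k : ℝ) ^ (2 : ℝ)))]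
  simp only [Real.rpow_two, ← one_div_mul_one_div]
  refine hzeta.tsum_eq.trans ?_
  norm_num
  ring

end Series

section Counting

theorem two_mul_pow_mul_le {a : ℝ} (m : ℕ) {n k : ℕ} (ha0 : 0 ≤ a) (ha : a ≤ 1 / 2) (hn : n ≠ 0)
    (hnk : n ≤ k) : 2 * m * a ^ k * k ≤ n * (2 * m * a) ^ n := by
  have hpow : (2 * k : ℝ) ≤ 2 ^ k := by
    obtain ⟨j, rfl⟩ := Nat.exists_eq_succ_of_ne_zero (hn.bot_lt.trans_le hnk).ne'
    rw [pow_succ']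
    gcongr
    exact_mod_cast Nat.lt_two_pow_self (n := j)
  have hm : (m : ℝ) ≤ (m : ℝ) ^ n := by exact_mod_cast Nat.le_self_pow hn m
  have hn1 : (1 : ℝ) ≤ n := by exact_mod_cast Nat.one_le_iff_ne_zero.2 hn
  calc 2 * m * a ^ k * k = m * a ^ k * (2 * k) := by ring
    _ ≤ (m : ℝ) ^ n * a ^ k * 2 ^ k := by gcongr
    _ = (m : ℝ) ^ n * (2 * a) ^ k := by ring
    _ ≤ (m : ℝ) ^ n * (2 * a) ^ n := by
        gcongr ?_ * ?_
        exact pow_le_pow_of_le_one (by positivity) (by linarith) hnk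
    _ = 1 * (2 * m * a) ^ n := by ring
    _ ≤ n * (2 * m * a) ^ n := by gcongr

theorem factorial_le_card_image_cons_eq {α : Type*} [Fintype α] [DecidableEq α] {n : ℕ} {q : α}
    {S : Finset α} (hq : q ∈ S) (hS : S.card = n + 1) :
    n.factorial ≤
      Finset.card {r : Fin n → α | Finset.univ.image (Fin.cons q r : Fin (n + 1) → α) = S} := by
  have e₀ : Fin n ≃ S.erase q :=
    (Fintype.equivFinOfCardEq
      (by rw [Fintype.card_coe, Finset.card_erase_of_mem hq, hS, Nat.add_sub_cancel])).symm
  have hcard : Fintype.card (Fin n ≃ S.erase q) = n.factorial := by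
    rw [Fintype.card_equiv e₀, Fintype.card_fin]
  rw [← hcard, ← Finset.card_univ]
  refine Finset.card_le_card_of_injOn (fun e j => (e j : α)) (fun e _ => ?_)
    fun e _ e' _ h => Equiv.ext fun j => Subtype.ext (congrFun h j)
  have himage : Finset.univ.image (fun j => (e j : α)) = S.erase q := by
    ext x
    simp only [Finset.mem_image, Finset.mem_univ, true_and]
    exact ⟨fun ⟨j, hj⟩ => hj ▸ (e j).2, fun hx => ⟨e.symm ⟨x, hx⟩, by rw [e.apply_symm_apply]⟩⟩
  simp only [Finset.coe_filter, Finset.mem_univ, true_and, Set.mem_ofPred_eq]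
  rw [Fin.univ_succ, Finset.cons_eq_insert, Finset.image_insert, Finset.map_eq_image,
    Finset.image_image]
  simp only [Function.comp_def, Function.Embedding.coeFn_mk, Fin.cons_zero, Fin.cons_succ, himage,
    Finset.insert_erase hq]

theorem sum_biUnion_le_sum_sum {ι α : Type*} [DecidableEq α] {s : Finset ι} {t : ι → Finset α}
    {f : α → ℝ} (hf : ∀ x, 0 ≤ f x) : ∑ x ∈ s.biUnion t, f x ≤ ∑ i ∈ s, ∑ x ∈ t i, f x := by
  classical
  rw [Finset.sum_comm' (t' := s.biUnion t) (s' := fun x => {i ∈ s | x ∈ t i}) (by aesop)]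
  refine Finset.sum_le_sum fun x hx => ?_
  obtain ⟨i, hi, hxi⟩ := Finset.mem_biUnion.1 hx
  exact Finset.single_le_sum (f := fun _ : ι => f x) (fun _ _ => hf x)
    (Finset.mem_filter.2 ⟨hi, hxi⟩)

end Counting

namespace NoiseModel

variable {Q Loc B : Type*} [Fintype Q] [DecidableEq Q] [Fintype Loc]
  [NormedAddCommGroup B] [InnerProductSpace ℂ B] [CompleteSpace B] (M : NoiseModel Q Loc B)

theorem maxDuration_nonneg : 0 ≤ M.maxDuration :=
  Real.iSup_nonneg fun l => (sub_pos.2 (M.start_lt_finish l)).le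

theorem duration_le_maxDuration (l : Loc) : M.finish l - M.start l ≤ M.maxDuration :=
  le_ciSup (f := fun l => M.finish l - M.start l) (Set.finite_range _).bddAbove l

theorem maxDuration_pos (l : Loc) : 0 < M.maxDuration :=
  (sub_pos.2 (M.start_lt_finish l)).trans_le (M.duration_le_maxDuration l)

theorem tupleTerm_of_image_eq {k : ℕ} {i : Fin k → Q} {S : Finset Q}
    (hi : Finset.univ.image i = S) (hS : S.card = k) (t : ℝ) : M.tupleTerm i t = M.term S t := by
  subst hi
  have hinj : Function.Injective i := by
    rw [← Set.injOn_univ, ← Finset.coe_univ, ← Finset.card_image_iff, hS, Finset.card_fin]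
  rw [tupleTerm, if_pos hinj]

theorem exists_norm_tupleTerm_le : ∃ c : ℝ, ∀ {k : ℕ} (i : Fin k → Q), ∀ t ∈ Set.Icc 0 M.T,
    ‖M.tupleTerm i t‖ ≤ c := by
  obtain ⟨c, hc⟩ := M.term_bounded
  refine ⟨max c 0, fun i t ht => ?_⟩
  rw [tupleTerm]
  split_ifs
  · exact le_max_of_le_left (hc _ t ht)
  · simp

theorem eta_nonneg (k : ℕ) : 0 ≤ M.eta k :=
  mul_nonneg (Real.iSup_nonneg fun _ => Finset.sum_nonneg fun _ _ => norm_nonneg _)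
    M.maxDuration_nonneg

theorem sum_norm_tupleTerm_mul_le_eta (n : ℕ) (q : Q) {t : ℝ} (ht : t ∈ Set.Icc 0 M.T) :
    (∑ r : Fin n → Q, ‖M.tupleTerm (Fin.cons q r : Fin (n + 1) → Q) t‖) * M.maxDuration ≤
      M.eta (n + 1) := by
  obtain ⟨c, hc⟩ := M.exists_norm_tupleTerm_le
  refine mul_le_mul_of_nonneg_right ?_ M.maxDuration_nonneg
  refine le_ciSup (f := fun x : Q × Set.Icc (0 : ℝ) M.T => ∑ r : Fin n → Q,
    ‖M.tupleTerm (Fin.cons x.1 r : Fin (n + 1) → Q) x.2‖) ⟨∑ _r : Fin n → Q, c, ?_⟩ (q, ⟨t, ht⟩)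
  rintro _ ⟨x, rfl⟩
  exact Finset.sum_le_sum fun r _ => hc _ _ x.2.2

theorem eta_eq_zero {k : ℕ} (hk : Fintype.card Q < k) : M.eta k = 0 := by
  have hinj (i : Fin (k - 1 + 1) → Q) : ¬Function.Injective i := fun hi => by
    have hcard := Fintype.card_le_of_injective i hi
    rw [Fintype.card_fin] at hcard
    lia
  simp [eta, tupleTerm, hinj]

theorem alpha_nonneg (p : ℝ) : 0 ≤ M.alpha p :=
  Real.iSup_nonneg fun k => Real.rpow_nonneg (mul_nonneg (by positivity) (M.eta_nonneg _)) _

theorem bddAbove_range_alpha (p : ℝ) : BddAbove (Set.range fun k : ℕ+ =>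
    (((k : ℕ) : ℝ) ^ p / ((k : ℕ).factorial : ℝ) * M.eta k) ^ (1 / ((k : ℕ) : ℝ))) := by
  set f : ℕ → ℝ := fun k => ((k : ℝ) ^ p / (k.factorial : ℝ) * M.eta k) ^ (1 / (k : ℝ))
  refine ((((Set.finite_Iic (Fintype.card Q)).image f).union (Set.finite_singleton 0)).subset
    ?_).bddAbove
  rintro _ ⟨k, rfl⟩
  rcases le_or_gt (k : ℕ) (Fintype.card Q) with hk | hk
  · exact .inl ⟨k, hk, rfl⟩
  · have hexp : (1 : ℝ) / ((k : ℕ) : ℝ) ≠ 0 := by positivity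
    right
    simp only [M.eta_eq_zero hk, mul_zero, Real.zero_rpow hexp, Set.mem_singleton_iff]

theorem rpow_div_factorial_mul_eta_le {p a : ℝ} (ha : M.alpha p ≤ a) {k : ℕ} (hk : k ≠ 0) :
    (k : ℝ) ^ p / (k.factorial : ℝ) * M.eta k ≤ a ^ k := by
  have hle : ((k : ℝ) ^ p / (k.factorial : ℝ) * M.eta k) ^ (1 / (k : ℝ)) ≤ a :=
    (le_ciSup (M.bddAbove_range_alpha p) ⟨k, hk.bot_lt⟩).trans ha
  have h0 : 0 ≤ (k : ℝ) ^ p / (k.factorial : ℝ) * M.eta k :=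
    mul_nonneg (by positivity) (M.eta_nonneg k)
  calc _ = (((k : ℝ) ^ p / (k.factorial : ℝ) * M.eta k) ^ (1 / (k : ℝ))) ^ k := by
        rw [one_div, Real.rpow_inv_natCast_pow h0 hk]
    _ ≤ a ^ k := by gcongr

theorem factorial_mul_sum_norm_term_le (n : ℕ) (q : Q) (t : ℝ) :
    (n.factorial : ℝ) * ∑ S with q ∈ S ∧ S.card = n + 1, ‖M.term S t‖ ≤
      ∑ r : Fin n → Q, ‖M.tupleTerm (Fin.cons q r : Fin (n + 1) → Q) t‖ := by
  set im : (Fin n → Q) → Finset Q := fun r => Finset.univ.image (Fin.cons q r : Fin (n + 1) → Q)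
  calc (n.factorial : ℝ) * ∑ S with q ∈ S ∧ S.card = n + 1, ‖M.term S t‖
      ≤ ∑ S with q ∈ S ∧ S.card = n + 1, ∑ r with im r = S,
          ‖M.tupleTerm (Fin.cons q r : Fin (n + 1) → Q) t‖ := by
        rw [Finset.mul_sum]
        refine Finset.sum_le_sum fun S hS => ?_
        obtain ⟨hq, hcard⟩ := (Finset.mem_filter.1 hS).2
        rw [Finset.sum_congr rfl fun r hr => by
          rw [M.tupleTerm_of_image_eq (Finset.mem_filter.1 hr).2 hcard], Finset.sum_const,
          nsmul_eq_mul]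
        gcongr
        exact factorial_le_card_image_cons_eq hq hcard
    _ ≤ ∑ r : Fin n → Q, ‖M.tupleTerm (Fin.cons q r : Fin (n + 1) → Q) t‖ :=
        Finset.sum_fiberwise_le_sum_of_sum_fiber_nonneg fun S _ =>
          Finset.sum_nonneg fun r _ => norm_nonneg _

/-- The weight of the term on `S` relative to that of the independent faults which replace it,
`2 a ^ |S| |S|`. -/
noncomputable def relativeNorm (a : ℝ) (S : Finset Q) (t : ℝ) : ℝ :=
  ‖M.term S t‖ / (2 * a ^ S.card * S.card)

theorem relativeNorm_nonneg {a : ℝ} (ha : 0 ≤ a) (S : Finset Q) (t : ℝ) :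
    0 ≤ M.relativeNorm a S t := by
  rw [relativeNorm]
  positivity

theorem sum_relativeNorm_of_card_mul_maxDuration_le {p a : ℝ} (ha0 : 0 < a) (ha : M.alpha p ≤ a)
    (n : ℕ) (q : Q) {t : ℝ} (ht : t ∈ Set.Icc 0 M.T) :
    (∑ S with q ∈ S ∧ S.card = n + 1, M.relativeNorm a S t) * M.maxDuration ≤
      1 / (2 * ((n + 1 : ℕ) : ℝ) ^ p) := by
  set σ := ∑ S with q ∈ S ∧ S.card = n + 1, ‖M.term S t‖
  set k : ℝ := ((n + 1 : ℕ) : ℝ)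
  have hk : 0 < k := by positivity
  have hfact : ((n + 1).factorial : ℝ) = k * n.factorial := by
    rw [Nat.factorial_succ, Nat.cast_mul]
  have hσ : k ^ p / k * (σ * M.maxDuration) ≤ a ^ (n + 1) := by
    calc k ^ p / k * (σ * M.maxDuration)
        = k ^ p / (n + 1).factorial * (n.factorial * σ * M.maxDuration) := by
          rw [hfact]
          field_simp
      _ ≤ k ^ p / (n + 1).factorial * M.eta (n + 1) := by
          gcongr
          exact (mul_le_mul_of_nonneg_right (M.factorial_mul_sum_norm_term_le n q t)
            M.maxDuration_nonneg).trans (M.sum_norm_tupleTerm_mul_le_eta n q ht)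
      _ ≤ a ^ (n + 1) := M.rpow_div_factorial_mul_eta_le ha n.succ_ne_zero
  have hsum : ∑ S with q ∈ S ∧ S.card = n + 1, M.relativeNorm a S t =
      σ / (2 * a ^ (n + 1) * k) := by
    rw [Finset.sum_div]
    refine Finset.sum_congr rfl fun S hS => ?_
    rw [relativeNorm, (Finset.mem_filter.1 hS).2.2]
  rw [hsum, div_mul_eq_mul_div, div_le_div_iff₀ (by positivity) (by positivity)]
  rw [div_mul_eq_mul_div, div_le_iff₀ hk] at hσ
  linarith

theorem sum_relativeNorm_mem_le {p a : ℝ} (hp : 1 < p) (ha0 : 0 < a) (ha : M.alpha p ≤ a) (q : Q)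
    {t : ℝ} (ht : t ∈ Set.Icc 0 M.T) :
    (∑ S with q ∈ S, M.relativeNorm a S t) * M.maxDuration ≤ halfZeta p := by
  have hcard {S : Finset Q} (hS : q ∈ S) : 0 < S.card := Finset.card_pos.2 ⟨q, hS⟩
  have hmaps : ∀ S ∈ Finset.univ.filter fun S : Finset Q => q ∈ S,
      S.card - 1 ∈ Finset.range (Fintype.card Q) := fun S hS => by
    have hpos := hcard (Finset.mem_filter.1 hS).2
    have hle := Finset.card_le_univ S
    rw [Finset.mem_range]
    lia
  have hfiber (n : ℕ) (S : Finset Q) :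
      q ∈ S ∧ S.card - 1 = n ↔ q ∈ S ∧ S.card = n + 1 :=
    and_congr_right fun hS => by have := hcard hS; lia
  rw [← Finset.sum_fiberwise_of_maps_to hmaps, Finset.sum_mul]
  refine (Finset.sum_le_sum fun n _ => ?_).trans (sum_range_le_halfZeta hp (Fintype.card Q))
  simp only [Finset.filter_filter, hfiber]
  exact M.sum_relativeNorm_of_card_mul_maxDuration_le ha0 ha n q ht

theorem sum_relativeNorm_struck_le [DecidableEq Loc] {p a : ℝ} (hp : 1 < p) (ha0 : 0 < a)
    (ha : M.alpha p ≤ a) (l : Loc) {t : ℝ} (ht : t ∈ Set.Icc 0 M.T) :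
    ∑ S with l ∈ M.struck S t, M.relativeNorm a S t ≤
      (M.qubits l).card * (M.window l).indicator (fun _ => halfZeta p / M.maxDuration) t := by
  by_cases hl : t ∈ M.window l
  · have hsub : Finset.univ.filter (fun S => l ∈ M.struck S t) ⊆
        (M.qubits l).biUnion fun q => {S | q ∈ S} := fun S hS => by
      obtain ⟨q, hq⟩ := (M.mem_struck.1 (Finset.mem_filter.1 hS).2).2
      rw [Finset.mem_inter] at hq
      simpa using ⟨q, hq.2, hq.1⟩
    have hnonneg := M.relativeNorm_nonneg ha0.le
    rw [Set.indicator_of_mem hl]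
    calc ∑ S with l ∈ M.struck S t, M.relativeNorm a S t
        ≤ ∑ q ∈ M.qubits l, ∑ S with q ∈ S, M.relativeNorm a S t :=
          (Finset.sum_le_sum_of_subset_of_nonneg hsub fun S _ _ => hnonneg S t).trans
            (sum_biUnion_le_sum_sum fun S => hnonneg S t)
      _ ≤ ∑ _q ∈ M.qubits l, halfZeta p / M.maxDuration :=
          Finset.sum_le_sum fun q _ =>
            (le_div_iff₀ (M.maxDuration_pos l)).2 (M.sum_relativeNorm_mem_le hp ha0 ha q ht)
      _ = (M.qubits l).card * (halfZeta p / M.maxDuration) := by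
          rw [Finset.sum_const, nsmul_eq_mul]
  · simp [mem_struck, hl]

-- The locations executed at a given time act on disjoint sets of qubits.
theorem card_struck_le (S : Finset Q) (t : ℝ) : (M.struck S t).card ≤ S.card := by
  have hdisj : (M.struck S t : Set Loc).PairwiseDisjoint fun l => S ∩ M.qubits l := by
    intro l hl l' hl' hne
    by_contra hqubits
    refine Set.disjoint_left.1 (M.disjoint l l' hne fun h => hqubits ?_) (M.mem_struck.1 hl).1
      (M.mem_struck.1 hl').1
    exact h.mono Finset.inter_subset_right Finset.inter_subset_right
  calc (M.struck S t).card ≤ ((M.struck S t).biUnion fun l => S ∩ M.qubits l).card :=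
        Finset.card_le_card_biUnion hdisj fun l hl => (M.mem_struck.1 hl).2
    _ ≤ S.card := Finset.card_le_card (Finset.biUnion_subset.2 fun _ _ => Finset.inter_subset_left)

theorem mul_norm_generators_op_le {a : ℝ} (ha0 : 0 < a) (ha : a ≤ 1 / 2) (m : ℕ) {n : ℕ}
    {S : Finset Q} (hn : n ≠ 0) (hnS : n ≤ S.card) {t : ℝ} (ht : t ∈ Set.Icc 0 M.T) :
    m * ‖M.generators.op S t‖ ≤ (2 * m * a) ^ n * (n * M.relativeNorm a S t) := by
  have hS : (S.card : ℝ) ≠ 0 := by exact_mod_cast (hn.bot_lt.trans_le hnS).ne'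
  calc m * ‖M.generators.op S t‖ ≤ m * ‖M.term S t‖ := by
        gcongr
        exact M.norm_generators_op_le S ht
    _ = 2 * m * a ^ S.card * S.card * M.relativeNorm a S t := by
        rw [relativeNorm]
        field_simp
    _ ≤ n * (2 * m * a) ^ n * M.relativeNorm a S t := by
        refine mul_le_mul_of_nonneg_right ?_ (M.relativeNorm_nonneg ha0.le S t)
        exact two_mul_pow_mul_le m ha0.le ha hn hnS
    _ = (2 * m * a) ^ n * (n * M.relativeNorm a S t) := by ring

theorem mul_norm_generators_op_mul_pow_le [DecidableEq Loc] {a : ℝ} (ha0 : 0 < a)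
    (ha : a ≤ 1 / 2) (m : ℕ) {R : Finset Loc} {S : Finset Q} {t : ℝ} (ht : t ∈ Set.Icc 0 M.T)
    (hR : ¬Disjoint R (M.struck S t)) :
    m * (‖M.generators.op S t‖ * (2 * m * a) ^ (R \ M.struck S t).card) ≤
      (2 * m * a) ^ R.card * ∑ l ∈ R with l ∈ M.struck S t, M.relativeNorm a S t := by
  set n := (R ∩ M.struck S t).card
  have hn : n ≠ 0 := Finset.card_ne_zero.2 (Finset.not_disjoint_iff_nonempty_inter.1 hR)
  have hnS : n ≤ S.card :=
    (Finset.card_le_card Finset.inter_subset_right).trans (M.card_struck_le S t)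
  rw [Finset.sum_const, Finset.filter_mem_eq_inter, nsmul_eq_mul,
    ← Finset.card_inter_add_card_sdiff R (M.struck S t), pow_add, ← mul_assoc,
    mul_right_comm _ _ ((n : ℝ) * _)]
  exact mul_le_mul_of_nonneg_right (M.mul_norm_generators_op_le ha0 ha m hn hnS ht) (by positivity)

theorem sum_norm_generators_op_mul_pow_le [DecidableEq Loc] {p a : ℝ} (hp : 1 < p) (ha0 : 0 < a)
    (hpa : M.alpha p ≤ a) (ha : a ≤ 1 / 2) {m : ℕ} (hm : ∀ l, (M.qubits l).card ≤ m)
    (R : Finset Loc) {t : ℝ} (ht : t ∈ Set.Icc 0 M.T) :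
    ∑ S with ¬Disjoint R (M.struck S t),
        ‖M.generators.op S t‖ * (2 * m * a) ^ (R \ M.struck S t).card ≤
      (2 * m * a) ^ R.card *
        ∑ l ∈ R, (M.window l).indicator (fun _ => halfZeta p / M.maxDuration) t := by
  rcases R.eq_empty_or_nonempty with rfl | ⟨l₀, -⟩
  · simp
  have hm0 : (0 : ℝ) < m := by
    exact_mod_cast (Finset.card_pos.2 (M.qubits_nonempty l₀)).trans_le (hm l₀)
  have hrel (S : Finset Q) := M.relativeNorm_nonneg ha0.le S t
  refine le_of_mul_le_mul_left ?_ hm0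
  rw [Finset.mul_sum, mul_left_comm, Finset.mul_sum R]
  calc ∑ S with ¬Disjoint R (M.struck S t),
        m * (‖M.generators.op S t‖ * (2 * m * a) ^ (R \ M.struck S t).card)
      ≤ ∑ S with ¬Disjoint R (M.struck S t),
          (2 * m * a) ^ R.card * ∑ l ∈ R with l ∈ M.struck S t, M.relativeNorm a S t :=
        Finset.sum_le_sum fun S hS =>
          M.mul_norm_generators_op_mul_pow_le ha0 ha m ht (Finset.mem_filter.1 hS).2
    _ ≤ ∑ S, (2 * m * a) ^ R.card * ∑ l ∈ R with l ∈ M.struck S t, M.relativeNorm a S t :=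
        Finset.sum_le_sum_of_subset_of_nonneg (Finset.filter_subset _ _) fun S _ _ =>
          mul_nonneg (by positivity) (Finset.sum_nonneg fun _ _ => hrel S)
    _ = (2 * m * a) ^ R.card *
          ∑ l ∈ R, ∑ S with l ∈ M.struck S t, M.relativeNorm a S t := by
        rw [← Finset.mul_sum]
        simp only [Finset.sum_filter]
        rw [Finset.sum_comm]
    _ ≤ _ := by
        gcongr with l
        refine (M.sum_relativeNorm_struck_le hp ha0 hpa l ht).trans ?_
        have hind : 0 ≤ (M.window l).indicator (fun _ => halfZeta p / M.maxDuration) t :=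
          Set.indicator_nonneg (fun _ _ => div_nonneg (halfZeta_nonneg p) M.maxDuration_nonneg) t
        gcongr
        exact_mod_cast hm l

theorem integral_window_div_maxDuration_le {D : ℝ} (hD : 0 ≤ D) (l : Loc) :
    ∫ τ in 0..M.T, (M.window l).indicator (fun _ => D / M.maxDuration) τ ≤ D := by
  have hwindow : MeasurableSet (M.window l) := measurableSet_Ico
  have hrate : 0 ≤ D / M.maxDuration := div_nonneg hD M.maxDuration_nonneg
  rw [intervalIntegral.integral_of_le M.T_nonneg]
  calc _ ≤ ∫ τ, (M.window l).indicator (fun _ => D / M.maxDuration) τ := by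
        refine setIntegral_le_integral ?_ (ae_of_all _ (Set.indicator_nonneg fun _ _ => hrate))
        rw [integrable_indicator_iff hwindow]
        exact integrableOn_const (by simp [Circuit.window])
    _ = (M.finish l - M.start l) * (D / M.maxDuration) := by
        rw [integral_indicator hwindow, setIntegral_const, smul_eq_mul]
        simp [Circuit.window, Measure.real, (M.start_lt_finish l).le]
    _ ≤ M.maxDuration * (D / M.maxDuration) := by
        gcongr
        exact M.duration_le_maxDuration l
    _ = D := mul_div_cancel₀ D (M.maxDuration_pos l).ne'

theorem norm_series_generators_le {p a : ℝ} (hp : 1 < p) (ha0 : 0 < a) (hpa : M.alpha p ≤ a)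
    (ha : a ≤ 1 / 2) {m : ℕ} (hm : ∀ l, (M.qubits l).card ≤ m) (I : Finset Loc)
    (ψ : JointSpace Q B) :
    ‖M.generators.series I M.T ψ‖ ≤ (2 * m * a * Real.exp (halfZeta p)) ^ I.card * ‖ψ‖ := by
  classical
  set k : Loc → ℝ → ℝ := fun l => (M.window l).indicator fun _ => halfZeta p / M.maxDuration
  have hk0 (l : Loc) (τ : ℝ) : 0 ≤ k l τ :=
    Set.indicator_nonneg (fun _ _ => div_nonneg (halfZeta_nonneg p) M.maxDuration_nonneg) τ
  have hk (l : Loc) (s : ℝ) : IntervalIntegrable (k l) volume 0 s :=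
    intervalIntegrable_iff.2 <| (intervalIntegrable_iff.1 intervalIntegrable_const).indicator
      measurableSet_Ico
  have hint : ∫ τ in 0..M.T, ∑ l ∈ I, k l τ ≤ I.card * halfZeta p := by
    rw [intervalIntegral.integral_finsetSum fun l _ => hk l M.T, ← nsmul_eq_mul,
      ← Finset.sum_const]
    exact Finset.sum_le_sum fun l _ =>
      M.integral_window_div_maxDuration_le (halfZeta_nonneg p) l
  refine (M.generators.norm_series_le (fun S t v => (M.re_inner_generators_op S t v).le)
    (w := 2 * m * a) (by positivity) hk hk0
    (fun R τ hτ => M.sum_norm_generators_op_mul_pow_le hp ha0 hpa ha hm R hτ) ψ I M.T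
    ⟨M.T_nonneg, le_rfl⟩).trans ?_
  rw [mul_pow (2 * m * a), ← Real.exp_nat_mul]
  gcongr

theorem hasEffectiveNoiseStrength_mul_exp_halfZeta {p : ℝ} (hp : 1 < p) {m : ℕ}
    (hm : ∀ l, (M.qubits l).card ≤ m) (hα : M.alpha p < 1 / 2) :
    M.HasEffectiveNoiseStrength (2 * m * M.alpha p * Real.exp (halfZeta p)) := by
  have hα0 := M.alpha_nonneg p
  refine ⟨by positivity, fun I => ?_⟩
  obtain ⟨E, hE, hnorm⟩ := M.exists_isFaultOperator I
  refine ⟨E, hE, ContinuousLinearMap.opNorm_le_bound _ (by positivity) fun ψ => ?_⟩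
  rw [hnorm]
  have hcont : ContinuousAt
      (fun a => (2 * m * a * Real.exp (halfZeta p)) ^ I.card * ‖ψ‖) (M.alpha p) := by fun_prop
  refine ge_of_tendsto (hcont.tendsto.mono_left (nhdsWithin_le_nhds (s := Set.Ioi (M.alpha p)))) ?_
  filter_upwards [Ioo_mem_nhdsGT hα] with a ha
  exact M.norm_series_generators_le hp (hα0.trans_lt ha.1) ha.1.le ha.2.le hm I ψ

variable {M} in
theorem HasEffectiveNoiseStrength.mono {ε ε' : ℝ} (h : M.HasEffectiveNoiseStrength ε)
    (hε : ε ≤ ε') : M.HasEffectiveNoiseStrength ε' := by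
  refine ⟨h.1.trans hε, fun I => ?_⟩
  obtain ⟨E, hE, hnorm⟩ := h.2 I
  exact ⟨E, hE, hnorm.trans (pow_le_pow_left₀ h.1 hε _)⟩

theorem hasEffectiveNoiseStrength_noiseBound {p : ℝ} (hp : 1 < p) {m : ℕ}
    (hm : ∀ l, (M.qubits l).card ≤ m) (hα : M.alpha p < 1 / 2) :
    M.HasEffectiveNoiseStrength (noiseBound m p (M.alpha p)) := by
  have hα0 := M.alpha_nonneg p
  have hC : 1 ≤ enhancement (M.alpha p) := (one_le_inv₀ (by linarith)).2 (by linarith)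
  refine (M.hasEffectiveNoiseStrength_mul_exp_halfZeta hp hm hα).mono ?_
  rw [noiseBound, ← halfZeta]
  gcongr
  exact le_mul_of_one_le_left (halfZeta_nonneg p) hC

end NoiseModel

theorem noiseBound_two (m : ℕ) (α : ℝ) :
    noiseBound m 2 α = 2 * m * α * Real.exp (Real.pi ^ 2 / 12) ^ enhancement α := by
  rw [noiseBound, ← halfZeta, halfZeta_two, ← Real.exp_mul, mul_comm (enhancement α)]

theorem continuousAt_enhancement_zero : ContinuousAt enhancement 0 := by
  have hne : (1 : ℝ) - 2 * 0 ≠ 0 := by norm_num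
  unfold enhancement
  fun_prop (disch := exact hne)

theorem tendsto_noiseBound_zero (m : ℕ) (p : ℝ) : Tendsto (noiseBound m p) (𝓝 0) (𝓝 0) := by
  have hcont : ContinuousAt (noiseBound m p) 0 := by
    unfold noiseBound
    have := continuousAt_enhancement_zero
    fun_prop
  simpa [noiseBound] using hcont.tendsto

theorem tendsto_noiseBound_two_div (m : ℕ) :
    Tendsto (fun α : ℝ => noiseBound m 2 α / α) (𝓝[>] 0)
      (𝓝 (m * (2 * Real.exp (Real.pi ^ 2 / 12)))) := by
  have hcont : ContinuousAt
      (fun α => m * (2 * Real.exp (enhancement α * (Real.pi ^ 2 / 12)))) 0 := by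
    have := continuousAt_enhancement_zero
    fun_prop
  have hlim := hcont.tendsto.mono_left (nhdsWithin_le_nhds (s := Set.Ioi 0))
  rw [enhancement, mul_zero, sub_zero, inv_one, one_mul] at hlim
  refine hlim.congr' ?_
  filter_upwards [self_mem_nhdsWithin] with α hα
  have hα0 : α ≠ 0 := ne_of_gt hα
  rw [noiseBound, ← halfZeta, halfZeta_two]
  field_simp

theorem abs_two_mul_exp_sub_lt : |2 * Real.exp (Real.pi ^ 2 / 12) - 4.55| < 0.005 := by
  have hpi_gt := Real.pi_gt_d4
  have hpi_lt := Real.pi_lt_d4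
  have hlower : (0.822 : ℝ) ≤ Real.pi ^ 2 / 12 := by nlinarith
  have hupper : Real.pi ^ 2 / 12 ≤ (0.8225 : ℝ) := by nlinarith
  have hexp_lower : (2.274 : ℝ) < Real.exp 0.822 := by
    refine lt_of_lt_of_le ?_ (Real.sum_le_exp_of_nonneg (x := 0.822) (by norm_num) 8)
    norm_num [Finset.sum_range_succ, Nat.factorial]
  have hexp_upper : Real.exp 0.8225 < (2.277 : ℝ) := by
    refine (Real.exp_bound' (x := 0.8225) (by norm_num) (by norm_num) (n := 8)
      (by norm_num)).trans_lt ?_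
    norm_num [Finset.sum_range_succ, Nat.factorial]
  have hmono_lower := Real.exp_le_exp.2 hlower
  have hmono_upper := Real.exp_le_exp.2 hupper
  rw [abs_lt]
  constructor <;> linarith

theorem corollary2 (p : ℝ) (hp : 1 < p) (m : ℕ) :
    -- the sum in the bound is finite
    (Summable fun k : ℕ+ => 1 / (2 * ((k : ℕ) : ℝ) ^ p)) ∧
    -- the bound on the effective noise strength
    (∀ (Q : Type*) (Loc : Type*) (B : Type*) [Fintype Q] [DecidableEq Q] [Fintype Loc]
        [NormedAddCommGroup B] [InnerProductSpace ℂ B] [CompleteSpace B]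
        (M : NoiseModel Q Loc B),
        (∀ l, (M.qubits l).card ≤ m) → M.alpha p < 1 / 2 →
          M.HasEffectiveNoiseStrength (noiseBound m p (M.alpha p))) ∧
    -- any threshold is met for all sufficiently small nonzero values, uniformly in the model
    (∀ ε₀ : ℝ, 0 < ε₀ → ∃ α₀ : ℝ, 0 < α₀ ∧
      ∀ (Q : Type*) (Loc : Type*) (B : Type*) [Fintype Q] [DecidableEq Q] [Fintype Loc]
        [NormedAddCommGroup B] [InnerProductSpace ℂ B] [CompleteSpace B]
        (M : NoiseModel Q Loc B),
        (∀ l, (M.qubits l).card ≤ m) → M.alpha p < α₀ →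
          ∃ ε < ε₀, M.HasEffectiveNoiseStrength ε) ∧
    -- the case `p = 2`: the bound is `2 m α (e^{π²/12})^{C(α)}`, about `4.55 m α` for small `α`
    (∀ α : ℝ, noiseBound m 2 α =
        2 * m * α * Real.exp (Real.pi ^ 2 / 12) ^ enhancement α) ∧
    Tendsto (fun α : ℝ => noiseBound m 2 α / α) (𝓝[>] 0)
        (𝓝 (m * (2 * Real.exp (Real.pi ^ 2 / 12)))) ∧
    |2 * Real.exp (Real.pi ^ 2 / 12) - 4.55| < 0.005 := by
  refine ⟨summable_one_div_two_mul_rpow hp, fun Q Loc B _ _ _ _ _ _ M hm hα =>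
    M.hasEffectiveNoiseStrength_noiseBound hp hm hα, fun ε₀ hε₀ => ?_, noiseBound_two m,
    tendsto_noiseBound_two_div m, abs_two_mul_exp_sub_lt⟩
  obtain ⟨δ, hδ, hsmall⟩ := Metric.eventually_nhds_iff.1
    ((tendsto_noiseBound_zero m p).eventually_lt_const hε₀)
  refine ⟨min δ (1 / 2), by positivity, fun Q Loc B _ _ _ _ _ _ M hm hα => ?_⟩
  obtain ⟨hαδ, hα⟩ := lt_min_iff.1 hα
  refine ⟨_, hsmall ?_, M.hasEffectiveNoiseStrength_noiseBound hp hm hα⟩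
  rwa [dist_zero_right, Real.norm_of_nonneg (M.alpha_nonneg p)]
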